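/- Let $P$ be a set with a symmetric reflexive relation $\mathcal C$ and let $k$ be a field. A labelled heap is a finite (possibly empty) poset $(E,\le)$ with a map $\varepsilon:E\to P$ such that $a,b$ are comparable whenever $\varepsilon(a)\,\mathcal C\,\varepsilon(b)$, and $\le$ is the transitive closure of the relation "$a\le b$ and $\varepsilon(a)\,\mathcal C\,\varepsilon(b)$". A heap is a labelled heap up to isomorphism of labelled posets; $H(P,\mathcal C)$ is the set of heaps. The subheap on a subset $S\subseteq E$ is $S$ with the restricted labelling and the transitive closure of the relation "$a\le b$ and $\varepsilon(a)\,\mathcal C\,\varepsilon(b)$" on $S$; write $E(a)$ for the subheap on $E\setminus\{a\}$. The superposition $E\circ F$ is the disjoint union $E\sqcup F$ with the inherited labels, ordered by the transitive closure of the relation given by the orders of $E$ and of $F$ together with the pairs $(a,b)$, $a\in E$, $b\in F$, whose labels are related by $\mathcal C$. An edge of $E$ is a pair $x<y$ with $\varepsilon(x)=\varepsilon(y)$ and no $z$ with the same label and $x<z<y$. The $k$-linear map $\partial_E$ from the $k$-span of the edges to the $k$-span of the vertices sends $(x,y)$ to $\sum w$, over all $w$ with $x<w<y$ and $\varepsilon(w)\,\mathcal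 C\,\varepsilon(x)$. $E$ has property P2 if it has no convex chain $x<z$ or $x<y<z$ with $\varepsilon(x)=\varepsilon(z)$. Write $E(a)\prec E$ if $a$ is maximal (respectively minimal) in $E$ and some maximal (respectively minimal) vertex $b$ of $E(a)$ with $\varepsilon(b)\neq\varepsilon(a)$ is not maximal (respectively minimal) in $E$. $E$ has property P1 if there is a (possibly trivial) sequence $E_1\prec E_2\prec\cdots\prec E$ in which no two distinct elements of $E_1$ are comparable. $H(P,\mathcal C)$ is regular if every heap in it with property P2 has property P1. Let $\mathcal A=\mathbb Z[v,v^{-1}]$ and $\delta=v+v^{-1}$. Let $\mathrm{Co}$ be the monoid generated by $P$ subject to $st=ts$ for all $s,t$ not related by $\mathcal C$. The algebra $TL(P,\mathcal C)$ is the quotient of the monoid algebra $\mathcal A\,\mathrm{Co}$ by the relations $ss=\delta s$, and $sts=s$ for $s\ne t$ with $s\,\mathcal C\,t$. A heap $E$ determines the element of $\mathrm{Co}$ given by the word of labels along any linear extension of $E$, and hence an element of $TL(P,\mathcal C)$, again denoted $E$. Then the heaps with property P2 form a free $\mathcal A$-basis of $TL(P,\mathcal C)$ (below, "basis element" means an element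 of this basis), and: (i) For every heap $D\in H(P,\mathcal C)$ there is a unique heap $G\in H(P,\mathcal C)$ with property P2 such that $D=\delta^m G$ in $TL(P,\mathcal C)$ for some integer $m\ge 0$. Whenever $G$ has property P2 and $D=\delta^mG$ with $m\ge0$, we have $\dim\ker\partial_D=m+\dim\ker\partial_G$; in particular, if $H(P,\mathcal C)$ is regular, then $m=\dim\ker\partial_D$. (ii) Suppose $H(P,\mathcal C)$ is regular, and let $E$ and $F$ be heaps with property P2, regarded as basis elements of $TL(P,\mathcal C)$. Then their product $EF$ in $TL(P,\mathcal C)$ equals $E\circ F$, and there is a basis element $G$ such that $E\circ F=\delta^{\dim\ker\partial_{E\circ F}}\,G$. -/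

import Mathlib

open scoped LaurentPolynomial

namespace HeapTL

universe u

/-- A concurrency relation on the set `P` of pieces: a symmetric and reflexive relation. -/
structure Concurrency (P : Type u) where
  rel : P → P → Prop
  refl : ∀ p, rel p p
  symm : ∀ p q, rel p q → rel q p

/-- A labelled heap with pieces in `P` and concurrency relation `C`: a finite (possibly empty)
partially ordered set with a labelling. Heaps are considered up to isomorphism below, so
nothing is lost by taking the underlying finite set in `Type`. -/
structure LabelledHeap (P : Type u) (C : Concurrency P) where
  carrier : Type
  fintype : Fintype carrier
  order : PartialOrder carrier
  label : carrier → P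
  comparable : ∀ a b : carrier, C.rel (label a) (label b) → a ≤ b ∨ b ≤ a
  le_iff : ∀ a b : carrier,
    a ≤ b ↔ Relation.TransGen (fun x y => x ≤ y ∧ C.rel (label x) (label y)) a b

theorem transGen_map {α β : Type} {r : α → α → Prop} {s : β → β → Prop} (f : α → β)
    (h : ∀ a b, r a b → s (f a) (f b)) {a b : α} (hab : Relation.TransGen r a b) :
    Relation.TransGen s (f a) (f b) := by
  induction hab with
  | single h' => exact .single (h _ _ h')
  | tail _ h' ih => exact ih.tail (h _ _ h')

namespace LabelledHeap

variable {P : Type u} {C : Concurrency P}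

instance : CoeSort (LabelledHeap P C) Type := ⟨LabelledHeap.carrier⟩

instance (E : LabelledHeap P C) : Fintype E := E.fintype

instance (E : LabelledHeap P C) : PartialOrder E := E.order

/-- Isomorphisms of labelled posets. -/
def Iso (E F : LabelledHeap P C) : Type :=
  {φ : E ≃o F // ∀ a, F.label (φ a) = E.label a}

/-- Being isomorphic as labelled posets. -/
instance isoSetoid (P : Type u) (C : Concurrency P) : Setoid (LabelledHeap P C) where
  r E F := Nonempty (Iso E F)
  iseqv :=
    { refl := fun E => ⟨⟨OrderIso.refl E, fun _ => rfl⟩⟩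
      symm := fun {_ F} ⟨φ⟩ => ⟨⟨φ.1.symm, fun a => by
        have h := φ.2 (φ.1.symm a)
        rw [OrderIso.apply_symm_apply] at h
        exact h.symm⟩⟩
      trans := fun ⟨φ⟩ ⟨ψ⟩ => ⟨⟨φ.1.trans ψ.1, fun a => (ψ.2 (φ.1 a)).trans (φ.2 a)⟩⟩ }

/-! ### Subheaps -/

/-- The relation generating the order of the subheap on `S`. -/
def subRel (E : LabelledHeap P C) (S : Set E) (a b : S) : Prop :=
  a.1 ≤ b.1 ∧ C.rel (E.label a.1) (E.label b.1)

theorem le_of_subRel (E : LabelledHeap P C) (S : Set E) {a b : S}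
    (h : Relation.TransGen (E.subRel S) a b) : a.1 ≤ b.1 := by
  induction h with
  | single h => exact h.1
  | tail _ h ih => exact ih.trans h.1

/-- The order of the subheap on `S`: the transitive closure of `subRel`. It is in general
weaker than the order induced from `E`. -/
@[reducible] def subOrder (E : LabelledHeap P C) (S : Set E) : PartialOrder S where
  le a b := Relation.TransGen (E.subRel S) a b
  lt a b := Relation.TransGen (E.subRel S) a b ∧ ¬ Relation.TransGen (E.subRel S) b a
  lt_iff_le_not_ge _ _ := Iff.rfl
  le_refl _ := Relation.TransGen.single ⟨le_refl _, C.refl _⟩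
  le_trans _ _ _ h₁ h₂ := h₁.trans h₂
  le_antisymm _ _ h₁ h₂ :=
    Subtype.ext (le_antisymm (E.le_of_subRel S h₁) (E.le_of_subRel S h₂))

/-- The subheap of `E` with set of vertices `S`. -/
noncomputable def subheap (E : LabelledHeap P C) (S : Set E) : LabelledHeap P C where
  carrier := S
  fintype := Fintype.ofFinite S
  order := E.subOrder S
  label a := E.label a.1
  comparable a b h := (E.comparable a.1 b.1 h).imp
    (fun hab => Relation.TransGen.single ⟨hab, h⟩)
    (fun hba => Relation.TransGen.single ⟨hba, C.symm _ _ h⟩)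
  le_iff a b := by
    constructor
    · intro h
      exact transGen_map id (fun x y hxy => ⟨Relation.TransGen.single hxy, hxy.2⟩) h
    · intro h
      induction h with
      | single h => exact h.1
      | tail _ h ih => exact Relation.TransGen.trans ih h.1

/-- The subheap `E(v)` obtained by deleting the vertex `v`. -/
noncomputable def delete (E : LabelledHeap P C) (v : E) : LabelledHeap P C :=
  E.subheap {w | w ≠ v}

/-! ### Superposition -/

/-- The relation generating the order of the superposition of `E` over `F`. -/
inductive SuperRel (E F : LabelledHeap P C) : E ⊕ F → E ⊕ F → Prop
  | left (a b : E) : a ≤ b → SuperRel E F (Sum.inl a) (Sum.inl b)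
  | right (a b : F) : a ≤ b → SuperRel E F (Sum.inr a) (Sum.inr b)
  | cross (a : E) (b : F) : C.rel (E.label a) (F.label b) →
      SuperRel E F (Sum.inl a) (Sum.inr b)

theorem superRel_inr (E F : LabelledHeap P C) {x y : E ⊕ F}
    (h : Relation.TransGen (SuperRel E F) x y) :
    ∀ b, x = Sum.inr b → ∃ b', y = Sum.inr b' ∧ b ≤ b' := by
  induction h with
  | single h =>
    rintro b rfl
    cases h with
    | right _ b' h => exact ⟨b', rfl, h⟩
  | tail _ h ih =>
    intro b hb
    obtain ⟨c, rfl, hc⟩ := ih b hb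
    cases h with
    | right _ b' h => exact ⟨b', rfl, hc.trans h⟩

theorem superRel_inl (E F : LabelledHeap P C) {x y : E ⊕ F}
    (h : Relation.TransGen (SuperRel E F) x y) :
    ∀ b, y = Sum.inl b → ∃ a, x = Sum.inl a ∧ a ≤ b := by
  induction h with
  | single h =>
    rintro b rfl
    cases h with
    | left a _ h => exact ⟨a, rfl, h⟩
  | tail _ h ih =>
    rintro b rfl
    cases h with
    | left a _ h =>
      obtain ⟨a', ha, hle⟩ := ih a rfl
      exact ⟨a', ha, hle.trans h⟩

/-- The order of the superposition of `E` over `F`: the transitive closure of `SuperRel`. -/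
@[reducible] def superOrder (E F : LabelledHeap P C) : PartialOrder (E ⊕ F) where
  le x y := Relation.TransGen (SuperRel E F) x y
  lt x y := Relation.TransGen (SuperRel E F) x y ∧ ¬ Relation.TransGen (SuperRel E F) y x
  lt_iff_le_not_ge _ _ := Iff.rfl
  le_refl x := by
    cases x with
    | inl a => exact Relation.TransGen.single (SuperRel.left a a le_rfl)
    | inr a => exact Relation.TransGen.single (SuperRel.right a a le_rfl)
  le_trans _ _ _ h₁ h₂ := h₁.trans h₂
  le_antisymm x y h₁ h₂ := by
    cases x with
    | inl a =>
      obtain ⟨b, rfl, hba⟩ := superRel_inl E F h₂ a rfl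
      obtain ⟨a', ha, hab⟩ := superRel_inl E F h₁ b rfl
      cases ha
      exact congrArg Sum.inl (le_antisymm hab hba)
    | inr a =>
      obtain ⟨b, rfl, hab⟩ := superRel_inr E F h₁ a rfl
      obtain ⟨a', ha, hba⟩ := superRel_inr E F h₂ b rfl
      cases ha
      exact congrArg Sum.inr (le_antisymm hab hba)

/-- The superposition `E ∘ F` of `E` over `F`, on the disjoint union. -/
def superpose (E F : LabelledHeap P C) : LabelledHeap P C where
  carrier := E ⊕ F
  fintype := inferInstance
  order := superOrder E F
  label := Sum.elim E.label F.label
  comparable a b h := by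
    rcases a with a | a <;> rcases b with b | b
    · exact (E.comparable a b h).imp (fun h => .single (.left _ _ h))
        (fun h => .single (.left _ _ h))
    · exact Or.inl (.single (.cross _ _ h))
    · exact Or.inr (.single (.cross _ _ (C.symm _ _ h)))
    · exact (F.comparable a b h).imp (fun h => .single (.right _ _ h))
        (fun h => .single (.right _ _ h))
  le_iff a b := by
    constructor
    · intro h
      have key : ∀ x y, SuperRel E F x y → Relation.TransGen
          (fun x y => Relation.TransGen (SuperRel E F) x y ∧
            C.rel (Sum.elim E.label F.label x) (Sum.elim E.label F.label y)) x y := by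
        intro x y hxy
        cases hxy with
        | left a b h =>
          exact transGen_map Sum.inl
            (fun x y h => ⟨.single (.left _ _ h.1), h.2⟩) ((E.le_iff a b).1 h)
        | right a b h =>
          exact transGen_map Sum.inr
            (fun x y h => ⟨.single (.right _ _ h.1), h.2⟩) ((F.le_iff a b).1 h)
        | cross a b h => exact .single ⟨.single (.cross _ _ h), h⟩
      change Relation.TransGen (SuperRel E F) a b at h
      induction h with
      | single h => exact key _ _ h
      | tail _ hbc ih => exact ih.trans (key _ _ hbc)
    · intro h
      induction h with
      | single h => exact h.1
      | tail _ h ih => exact Relation.TransGen.trans ih h.1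

theorem superRel_map {E E' F F' : LabelledHeap P C} (φ : Iso E E') (ψ : Iso F F')
    {x y : E ⊕ F} (h : SuperRel E F x y) :
    SuperRel E' F' (Sum.map φ.1 ψ.1 x) (Sum.map φ.1 ψ.1 y) := by
  cases h with
  | left a b h => exact .left _ _ (φ.1.monotone h)
  | right a b h => exact .right _ _ (ψ.1.monotone h)
  | cross a b h => exact .cross _ _ (by rw [φ.2, ψ.2]; exact h)

theorem superpose_congr {E E' F F' : LabelledHeap P C} (hE : E ≈ E') (hF : F ≈ F') :
    superpose E F ≈ superpose E' F' := by
  obtain ⟨φ⟩ := hE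
  obtain ⟨ψ⟩ := hF
  refine ⟨⟨⟨Equiv.sumCongr φ.1.toEquiv ψ.1.toEquiv, ?_⟩, ?_⟩⟩
  · intro x y
    constructor
    · intro h
      have φs : ∀ a, E.label (φ.1.symm a) = E'.label a := fun a => by
        rw [← φ.2, OrderIso.apply_symm_apply]
      have ψs : ∀ a, F.label (ψ.1.symm a) = F'.label a := fun a => by
        rw [← ψ.2, OrderIso.apply_symm_apply]
      have h' := transGen_map (Sum.map φ.1.symm ψ.1.symm)
        (fun _ _ h => superRel_map (⟨φ.1.symm, φs⟩ : Iso E' E)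
          (⟨ψ.1.symm, ψs⟩ : Iso F' F) h) h
      have hid : ∀ z : E ⊕ F, Sum.map φ.1.symm ψ.1.symm
          (Equiv.sumCongr φ.1.toEquiv ψ.1.toEquiv z) = z := by
        rintro (z | z)
        · exact congrArg Sum.inl (φ.1.symm_apply_apply z)
        · exact congrArg Sum.inr (ψ.1.symm_apply_apply z)
      have hx := hid x
      have hy := hid y
      change Relation.TransGen (SuperRel E F) x y
      exact hx ▸ hy ▸ h'
    · intro h
      exact transGen_map (Sum.map φ.1 ψ.1) (fun _ _ h => superRel_map φ ψ h) h
  · rintro (a | a)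
    · exact φ.2 a
    · exact ψ.2 a

/-! ### The map `∂` -/

/-- The edges of `E`: pairs of consecutive vertices with the same label. -/
def Edge (E : LabelledHeap P C) : Type :=
  {e : E × E // e.1 < e.2 ∧ E.label e.1 = E.label e.2 ∧
    ¬ ∃ z, E.label z = E.label e.1 ∧ e.1 < z ∧ z < e.2}

open Classical in
/-- The sum of all `w` with `x < w < y` whose label is concurrent to that of `x`. -/
noncomputable def edgeBoundary (k : Type*) [Field k] (E : LabelledHeap P C) (x y : E) :
    E →₀ k :=
  ∑ w : E with x < w ∧ w < y ∧ C.rel (E.label w) (E.label x), Finsupp.single w 1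

/-- The `k`-linear map `∂_E` from the span of the edges to the span of the vertices. -/
noncomputable def boundary (k : Type*) [Field k] (E : LabelledHeap P C) :
    (E.Edge →₀ k) →ₗ[k] (E →₀ k) :=
  Finsupp.linearCombination k (fun e : E.Edge => E.edgeBoundary k e.1.1 e.1.2)

/-- `dim ker ∂_E`. -/
noncomputable def dimKer (k : Type*) [Field k] (E : LabelledHeap P C) : ℕ :=
  Module.finrank k (LinearMap.ker (E.boundary k))

/-- The bijection between edges given by an isomorphism. -/
def Iso.edgeEquiv {E F : LabelledHeap P C} (φ : Iso E F) : E.Edge ≃ F.Edge :=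
  Equiv.subtypeEquiv (Equiv.prodCongr φ.1.toEquiv φ.1.toEquiv) (by
    rintro ⟨x, y⟩
    refine and_congr φ.1.lt_iff_lt.symm (and_congr ?_ (not_congr ?_))
    · exact (by rw [← φ.2 x, ← φ.2 y]; rfl)
    · constructor
      · rintro ⟨z, hz, h₁, h₂⟩
        exact ⟨φ.1 z, ((φ.2 z).trans hz).trans (φ.2 x).symm, φ.1.lt_iff_lt.2 h₁,
          φ.1.lt_iff_lt.2 h₂⟩
      · rintro ⟨z, hz, h₁, h₂⟩
        refine ⟨φ.1.symm z, ?_, φ.1.lt_symm_apply.2 h₁, φ.1.symm_apply_lt.2 h₂⟩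
        rw [← φ.2 (φ.1.symm z), OrderIso.apply_symm_apply]
        exact hz.trans (φ.2 x))

theorem Iso.edgeBoundary_map (k : Type*) [Field k] {E F : LabelledHeap P C} (φ : Iso E F)
    (x y : E) : Finsupp.domLCongr (R := k) (M := k) φ.1.toEquiv (E.edgeBoundary k x y) =
      F.edgeBoundary k (φ.1 x) (φ.1 y) := by
  classical
  unfold edgeBoundary
  rw [map_sum]
  refine Finset.sum_bij (fun w _ => φ.1 w) ?_ ?_ ?_ ?_
  · intro w hw
    simpa [φ.2] using hw
  · intro a _ b _ h
    exact φ.1.injective h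
  · intro w hw
    refine ⟨φ.1.symm w, ?_, φ.1.apply_symm_apply w⟩
    have hl : E.label (φ.1.symm w) = F.label w := by
      rw [← φ.2, OrderIso.apply_symm_apply]
    simp only [Finset.mem_filter, Finset.mem_univ, true_and, φ.2] at hw ⊢
    exact ⟨φ.1.lt_symm_apply.2 hw.1, φ.1.symm_apply_lt.2 hw.2.1, by rw [hl]; exact hw.2.2⟩
  · intro w _
    simp

theorem dimKer_congr (k : Type*) [Field k] {E F : LabelledHeap P C} (h : E ≈ F) :
    E.dimKer k = F.dimKer k := by
  obtain ⟨φ⟩ := h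
  have hcomm : ∀ x, Finsupp.domLCongr (R := k) (M := k) φ.1.toEquiv (E.boundary k x) =
      F.boundary k (Finsupp.domLCongr (R := k) (M := k) φ.edgeEquiv x) := by
    intro x
    induction x using Finsupp.induction_linear with
    | zero => simp
    | add f g hf hg => simp only [map_add, hf, hg]
    | single e c =>
      rw [Finsupp.domLCongr_single]
      unfold boundary
      rw [Finsupp.linearCombination_single, Finsupp.linearCombination_single, map_smul,
        Iso.edgeBoundary_map k φ]
      rfl
  unfold dimKer
  refine LinearEquiv.finrank_eq
    (LinearEquiv.ofSubmodules (Finsupp.domLCongr (R := k) (M := k) φ.edgeEquiv) _ _ ?_)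
  ext y
  constructor
  · rintro ⟨x, hx, rfl⟩
    have hx' : E.boundary k x = 0 := hx
    change F.boundary k (Finsupp.domLCongr (R := k) (M := k) φ.edgeEquiv x) = 0
    rw [← hcomm, hx', map_zero]
  · intro hy
    have hy' : F.boundary k y = 0 := hy
    refine ⟨(Finsupp.domLCongr (R := k) (M := k) φ.edgeEquiv).symm y, ?_, LinearEquiv.apply_symm_apply _ _⟩
    change E.boundary k _ = 0
    apply (Finsupp.domLCongr (R := k) (M := k) φ.1.toEquiv).injective
    rw [hcomm, LinearEquiv.apply_symm_apply, hy', map_zero]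

/-! ### Trivial heaps, dismantling, property P2 -/

/-- No element is above any other. -/
def IsTrivial (E : LabelledHeap P C) : Prop := ∀ a b : E, a ≤ b → a = b

/-- `E(a) ≺⁺ E`. -/
def PrecPlus (E : LabelledHeap P C) (a : E) : Prop :=
  IsMax a ∧ ∃ b : E.delete a, IsMax b ∧ E.label b.1 ≠ E.label a ∧ ¬ IsMax b.1

/-- `E(a) ≺⁻ E`. -/
def PrecMinus (E : LabelledHeap P C) (a : E) : Prop :=
  IsMin a ∧ ∃ b : E.delete a, IsMin b ∧ E.label b.1 ≠ E.label a ∧ ¬ IsMin b.1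

/-- The list `l` is a convex chain `x₁ < x₂ < ⋯ < x_t` in `E`. -/
def IsConvexChain (E : LabelledHeap P C) (l : List E) : Prop :=
  l.Pairwise (· < ·) ∧ ∀ a ∈ l, ∀ b ∈ l, ∀ y, a < y → y < b → y ∈ l

/-- Property P2: there are no convex chains `x < z` or `x < y < z` for which `x` and `z` have
the same label. -/
def HasP2 (E : LabelledHeap P C) : Prop :=
  (∀ x z : E, E.label x = E.label z → ¬ E.IsConvexChain [x, z]) ∧
  (∀ x y z : E, E.label x = E.label z → ¬ E.IsConvexChain [x, y, z])

theorem IsConvexChain.map {E F : LabelledHeap P C} (φ : Iso E F) {l : List E}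
    (h : E.IsConvexChain l) : F.IsConvexChain (l.map φ.1) := by
  refine ⟨List.pairwise_map.2 (h.1.imp fun hab => φ.1.lt_iff_lt.2 hab), ?_⟩
  intro a ha b hb y hay hyb
  obtain ⟨a', ha', rfl⟩ := List.mem_map.1 ha
  obtain ⟨b', hb', rfl⟩ := List.mem_map.1 hb
  exact List.mem_map.2 ⟨φ.1.symm y, h.2 a' ha' b' hb' _ (φ.1.lt_symm_apply.2 hay)
    (φ.1.symm_apply_lt.2 hyb), φ.1.apply_symm_apply y⟩

theorem HasP2.of_equiv {E F : LabelledHeap P C} (h : E ≈ F) (hF : F.HasP2) : E.HasP2 := by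
  obtain ⟨φ⟩ := h
  refine ⟨fun x z hl hc => hF.1 (φ.1 x) (φ.1 z) ?_ (hc.map φ),
    fun x y z hl hc => hF.2 (φ.1 x) (φ.1 y) (φ.1 z) ?_ (hc.map φ)⟩ <;>
  rw [φ.2, φ.2, hl]

end LabelledHeap

/-! ### Heaps -/

/-- The set `H(P, C)` of heaps: labelled heaps up to isomorphism of labelled posets. -/
def Heap (P : Type u) (C : Concurrency P) := Quotient (LabelledHeap.isoSetoid P C)

namespace Heap

variable {P : Type u} {C : Concurrency P}

/-- The heap `[E, ≤, ε]` of a labelled heap. -/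
def mk (E : LabelledHeap P C) : Heap P C := Quotient.mk _ E

/-- The superposition of heaps. -/
def superpose : Heap P C → Heap P C → Heap P C :=
  Quotient.map₂ LabelledHeap.superpose
    (fun _ _ hE _ _ hF => LabelledHeap.superpose_congr hE hF)

/-- `dim ker ∂_E` for a heap `E`. -/
noncomputable def dimKer (k : Type*) [Field k] : Heap P C → ℕ :=
  Quotient.lift (LabelledHeap.dimKer k) (fun _ _ h => LabelledHeap.dimKer_congr k h)

/-- Property P2 for heaps. -/
def HasP2 : Heap P C → Prop :=
  Quotient.lift LabelledHeap.HasP2 (fun _ _ h =>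
    propext ⟨LabelledHeap.HasP2.of_equiv (Setoid.symm h), LabelledHeap.HasP2.of_equiv h⟩)

/-- The heap is trivial. -/
def IsTrivial (E : Heap P C) : Prop := ∃ E' : LabelledHeap P C, mk E' = E ∧ E'.IsTrivial

/-- `F ≺ E`: the heap `F` is of the form `E(a)` with `E(a) ≺⁺ E` or `E(a) ≺⁻ E`. -/
def Prec (F E : Heap P C) : Prop :=
  ∃ (E' : LabelledHeap P C) (a : E'),
    mk E' = E ∧ mk (E'.delete a) = F ∧ (E'.PrecPlus a ∨ E'.PrecMinus a)

/-- Property P1 (dismantlability): there is a possibly trivial sequence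
`E₁ ≺ E₂ ≺ ⋯ ≺ E` starting at a trivial heap `E₁`. -/
def HasP1 (E : Heap P C) : Prop :=
  ∃ T : Heap P C, T.IsTrivial ∧ Relation.ReflTransGen Prec T E

end Heap

/-- The class `H(P, C)` is regular if property P2 implies property P1 for its heaps. -/
def IsRegular {P : Type u} (C : Concurrency P) : Prop :=
  ∀ E : Heap P C, E.HasP2 → E.HasP1

/-! ### The commutation monoid and linear extensions -/

/-- The commutation relations `p q ≡ q p` on words, for `p` and `q` not concurrent. -/
inductive CommRel {P : Type u} (C : Concurrency P) : FreeMonoid P → FreeMonoid P → Prop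
  | swap (p q : P) : ¬ C.rel p q →
      CommRel C (FreeMonoid.of p * FreeMonoid.of q) (FreeMonoid.of q * FreeMonoid.of p)

/-- The commutation monoid of the complementary relation of `C`. -/
abbrev Co {P : Type u} (C : Concurrency P) : Type u := (conGen (CommRel C)).Quotient

/-- The class of a word in the commutation monoid. -/
def Co.word {P : Type u} (C : Concurrency P) (l : List P) : Co C :=
  (conGen (CommRel C)).mk' (FreeMonoid.ofList l)

namespace LabelledHeap

variable {P : Type u} {C : Concurrency P}

/-- A natural labelling of `E`: an order-preserving numbering of its `n` elements. -/
structure NaturalLabelling (E : LabelledHeap P C) where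
  toEquiv : E ≃ Fin (Fintype.card E)
  strictMono : ∀ a b : E, a < b → toEquiv a < toEquiv b

/-- The linear extension `p₁ p₂ ⋯ p_n` of `E` given by a natural labelling. -/
def NaturalLabelling.word {E : LabelledHeap P C} (π : E.NaturalLabelling) : List P :=
  List.ofFn (fun i => E.label (π.toEquiv.symm i))

theorem nonempty_naturalLabelling (E : LabelledHeap P C) : Nonempty E.NaturalLabelling := by
  classical
  let _ : Fintype (LinearExtension E) := E.fintype
  let e : Fin (Fintype.card E) ≃o LinearExtension E :=
    Fintype.orderIsoFinOfCardEq (LinearExtension E) rfl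
  let t : E → LinearExtension E := toLinearExtension
  refine ⟨⟨e.symm.toEquiv, fun a b h => ?_⟩⟩
  refine e.symm.lt_iff_lt.2 (lt_of_le_of_ne (toLinearExtension.monotone h.le) ?_)
  exact fun h' => h.ne h'

theorem Co.word_cons (p : P) (l : List P) :
    Co.word C (p :: l) = Co.word C [p] * Co.word C l := by
  unfold Co.word
  rw [← map_mul]
  rfl

theorem Co.word_append (l l' : List P) :
    Co.word C (l ++ l') = Co.word C l * Co.word C l' := by
  unfold Co.word
  rw [← map_mul]
  rfl

theorem Co.word_swap {p q : P} (h : ¬ C.rel p q) :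
    Co.word C [p] * Co.word C [q] = Co.word C [q] * Co.word C [p] :=
  (Con.eq _).2 (ConGen.Rel.of _ _ (CommRel.swap p q h))

theorem Co.word_move (p : P) (s : List P) (h : ∀ q ∈ s, ¬ C.rel p q) :
    Co.word C s * Co.word C [p] = Co.word C [p] * Co.word C s := by
  induction s with
  | nil => exact (one_mul (Co.word C [p])).trans (mul_one (Co.word C [p])).symm
  | cons q s ih =>
    rw [Co.word_cons q s, mul_assoc, ih (fun r hr => h r (List.mem_cons_of_mem _ hr)),
      ← mul_assoc, ← mul_assoc, Co.word_swap (h q List.mem_cons_self)]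

theorem word_eq_of_perm (E : LabelledHeap P C) (l₁ : List E) :
    ∀ l₂ : List E, l₁.Nodup → l₁.Perm l₂ →
      l₁.Pairwise (fun a b => ¬ b < a) → l₂.Pairwise (fun a b => ¬ b < a) →
      Co.word C (l₁.map E.label) = Co.word C (l₂.map E.label) := by
  induction l₁ with
  | nil =>
    intro l₂ _ hp _ _
    rw [List.nil_perm.1 hp]
  | cons a t ih =>
    intro l₂ hn hp h₁ h₂
    obtain ⟨s, r, rfl⟩ := List.append_of_mem (hp.subset List.mem_cons_self)
    have hp' : t.Perm (s ++ r) := (hp.trans List.perm_middle).cons_inv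
    rw [List.nodup_cons] at hn
    rw [List.pairwise_cons] at h₁
    rw [List.pairwise_append] at h₂
    have hs : ∀ q ∈ s.map E.label, ¬ C.rel (E.label a) q := by
      intro q hq hC
      obtain ⟨b, hb, rfl⟩ := List.mem_map.1 hq
      have hbt : b ∈ t := hp'.symm.subset (List.mem_append_left _ hb)
      have hne : a ≠ b := fun h => hn.1 (h ▸ hbt)
      rcases E.comparable a b hC with h | h
      · exact h₂.2.2 b hb a List.mem_cons_self (lt_of_le_of_ne h hne)
      · exact h₁.1 b hbt (lt_of_le_of_ne h hne.symm)
    have ih' := ih (s ++ r) hn.2 hp' h₁.2 (List.pairwise_append.2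
      ⟨h₂.1, (List.pairwise_cons.1 h₂.2.1).2,
        fun x hx y hy => h₂.2.2 x hx y (List.mem_cons_of_mem _ hy)⟩)
    rw [List.map_cons, Co.word_cons, ih', List.map_append, List.map_append, List.map_cons,
      Co.word_append, Co.word_append, Co.word_cons (E.label a) (r.map E.label), ← mul_assoc,
      ← mul_assoc, Co.word_move _ _ hs]

/-- All linear extensions of isomorphic labelled heaps agree in the commutation monoid. -/
theorem word_independent {E F : LabelledHeap P C} (h : E ≈ F) (π : E.NaturalLabelling)
    (σ : F.NaturalLabelling) : Co.word C π.word = Co.word C σ.word := by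
  obtain ⟨φ⟩ := h
  have h₁ : π.word = (List.ofFn (fun i => π.toEquiv.symm i)).map E.label := by
    rw [List.map_ofFn]
    rfl
  have h₂ : σ.word = (List.ofFn (fun i => φ.1.symm (σ.toEquiv.symm i))).map E.label := by
    rw [List.map_ofFn]
    refine congrArg List.ofFn (funext fun i => ?_)
    change F.label _ = E.label (φ.1.symm _)
    rw [← φ.2, OrderIso.apply_symm_apply]
  have n₁ : (List.ofFn (fun i => π.toEquiv.symm i)).Nodup :=
    List.nodup_ofFn.2 π.toEquiv.symm.injective
  have n₂ : (List.ofFn (fun i => φ.1.symm (σ.toEquiv.symm i))).Nodup :=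
    List.nodup_ofFn.2 (φ.1.symm.injective.comp σ.toEquiv.symm.injective)
  rw [h₁, h₂]
  refine E.word_eq_of_perm _ _ n₁ ((List.perm_ext_iff_of_nodup n₁ n₂).2 fun a => ?_) ?_ ?_
  · simp only [List.mem_ofFn]
    exact ⟨fun _ => ⟨σ.toEquiv (φ.1 a), by simp⟩, fun _ => ⟨π.toEquiv a, by simp⟩⟩
  · rw [List.pairwise_ofFn]
    intro i j hij hlt
    have := π.strictMono _ _ hlt
    simp only [Equiv.apply_symm_apply] at this
    exact lt_asymm hij this
  · rw [List.pairwise_ofFn]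
    intro i j hij hlt
    have := σ.strictMono _ _ (φ.1.symm.lt_iff_lt.1 hlt)
    simp only [Equiv.apply_symm_apply] at this
    exact lt_asymm hij this

end LabelledHeap

/-- The map from heaps to the commutation monoid, sending a heap to any of its linear
extensions. -/
noncomputable def Heap.toCo {P : Type u} {C : Concurrency P} : Heap P C → Co C :=
  Quotient.lift (fun E : LabelledHeap P C => Co.word C E.nonempty_naturalLabelling.some.word)
    (fun _ _ h => LabelledHeap.word_independent h _ _)

/-! ### The generalized Temperley–Lieb algebra -/

/-- `δ = v + v⁻¹` in the ring `ℤ[v, v⁻¹]` of Laurent polynomials. -/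
noncomputable def delta : ℤ[T;T⁻¹] := LaurentPolynomial.T 1 + LaurentPolynomial.T (-1)

/-- The monoid algebra of the commutation monoid over `ℤ[v, v⁻¹]`. -/
abbrev CoAlg {P : Type u} (C : Concurrency P) : Type u := MonoidAlgebra ℤ[T;T⁻¹] (Co C)

/-- The element of the monoid algebra given by a piece. -/
noncomputable def gen {P : Type u} (C : Concurrency P) (p : P) : CoAlg C :=
  MonoidAlgebra.of ℤ[T;T⁻¹] (Co C) (Co.word C [p])

/-- The relations `s s = δ s`, and `s t s = s` for distinct concurrent `s` and `t`. -/
inductive TLRel {P : Type u} (C : Concurrency P) : CoAlg C → CoAlg C → Prop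
  | sq (s : P) : TLRel C (gen C s * gen C s) (delta • gen C s)
  | braid (s t : P) : s ≠ t → C.rel s t → TLRel C (gen C s * gen C t * gen C s) (gen C s)

/-- The generalized Temperley–Lieb algebra `TL(P, C)` over `ℤ[v, v⁻¹]`. -/
abbrev TL {P : Type u} (C : Concurrency P) : Type u := RingQuot (TLRel C)

/-- The image of a heap in `TL(P, C)`. -/
noncomputable def Heap.toTL {P : Type u} {C : Concurrency P} (E : Heap P C) : TL C :=
  RingQuot.mkAlgHom ℤ[T;T⁻¹] (TLRel C) (MonoidAlgebra.of ℤ[T;T⁻¹] (Co C) E.toCo)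

end HeapTL

/-! The defining relations are read as rewriting rules on heaps, `s s → δ s` and `s t s → s`;
`Heap.Red i` is one such step, `i` being the exponent of δ it produces. The basis and the uniqueness
of `G` come from confluence of this rewriting. The dimension formula holds because each step lowers
dim ker ∂ by exactly the exponent it produces.

Heaps form a monoid isomorphic to the commutation monoid, and a factorisation of a heap is an
ordered partition of its vertices (`exists_levels`). A place where a rule applies is therefore a
pair x < z of equally labelled vertices whose open interval is empty or one vertex with a different,
concurrent label (`IsRedex`), and the irreducible heaps are those with P2 (`hasP2_iff_irred`). Two
redexes coincide, overlap as in `s t s t`, share only their middle vertex, or can be reduced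
independently; this is `Red.locally_confluent`. Every step loses vertices, so Newman's argument
gives a unique normal form (`NF.unique`), and the P2 heaps span. For independence, the free module
on the P2 heaps becomes a module over the algebra by multiplying and then normalising; acting on the
empty heap returns the normal form (`coords_toTL`).

For the kernel, a combination of edges is encoded by its jumps, a function on vertices with zero sum
over each label. Being a cycle becomes a system of linear equations `lowerSum w = 0`, and the
kernels of all subheaps of `E` lie in the one space `E → k` (`cycleSpace`, `dimKer_subheap`).
Reducing a redex is then elementary linear algebra (`Red.dimKer_eq`). A dismantling step forces
cycles to vanish at the removed vertex, so P1 makes the kernel zero (`HasP1.dimKer_eq_zero`). In the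
regular case the normal form thus contributes nothing and the exponent is dim ker ∂. -/

namespace HeapTL

universe u

variable {P : Type u} {C : Concurrency P}

/-! ### Isomorphisms between subheaps and superpositions -/

namespace LabelledHeap

/-- A label preserving bijection which is monotone on concurrent pairs is an isomorphism. -/
theorem equiv_of_monotone {E F : LabelledHeap P C} (φ : E ≃ F)
    (hl : ∀ a, F.label (φ a) = E.label a)
    (h : ∀ a b, C.rel (E.label a) (E.label b) → a ≤ b → φ a ≤ φ b) : E ≈ F := by
  have hs : ∀ x, E.label (φ.symm x) = F.label x := fun x => by
    rw [← hl, Equiv.apply_symm_apply]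
  refine ⟨⟨⟨φ, ?_⟩, hl⟩⟩
  intro a b
  constructor
  · intro hab
    have h' := transGen_map (s := fun x y => x ≤ y ∧ C.rel (E.label x) (E.label y)) φ.symm
      (fun x y hxy => by
        have hc : C.rel (E.label (φ.symm x)) (E.label (φ.symm y)) := by
          rw [hs, hs]; exact hxy.2
        refine ⟨?_, hc⟩
        -- Concurrent labels make the preimages comparable; if they are in the wrong order,
        -- monotonicity and antisymmetry make them equal.
        rcases E.comparable _ _ hc with h1 | h1
        · exact h1
        · have := h _ _ (C.symm _ _ hc) h1
          rw [Equiv.apply_symm_apply, Equiv.apply_symm_apply] at this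
          rw [le_antisymm this hxy.1]) ((F.le_iff _ _).1 hab)
    rw [Equiv.symm_apply_apply, Equiv.symm_apply_apply] at h'
    exact (E.le_iff _ _).2 h'
  · intro hab
    refine (F.le_iff _ _).2 (transGen_map φ (fun x y hxy => ⟨h x y hxy.2 hxy.1, ?_⟩)
      ((E.le_iff _ _).1 hab))
    rw [hl, hl]; exact hxy.2

theorem subheap_le_of_le (E : LabelledHeap P C) {S : Set E} {a b : E.subheap S}
    (hC : C.rel (E.label a.1) (E.label b.1)) (h : a.1 ≤ b.1) : a ≤ b :=
  Relation.TransGen.single ⟨h, hC⟩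

theorem le_of_subheap_le (E : LabelledHeap P C) {S : Set E} {a b : E.subheap S}
    (h : a ≤ b) : a.1 ≤ b.1 := E.le_of_subRel S h

theorem superpose_le_of_inl {E F : LabelledHeap P C} {a b : E}
    (h : @LE.le (E.superpose F) _ (Sum.inl a) (Sum.inl b)) : a ≤ b := by
  obtain ⟨a', ha, hle⟩ := superRel_inl E F h b rfl
  cases ha
  exact hle

theorem superpose_le_of_inr {E F : LabelledHeap P C} {a b : F}
    (h : @LE.le (E.superpose F) _ (Sum.inr a) (Sum.inr b)) : a ≤ b := by
  obtain ⟨a', ha, hle⟩ := superRel_inr E F h a rfl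
  cases ha
  exact hle

theorem superpose_not_inr_le_inl {E F : LabelledHeap P C} {a : F} {b : E} :
    ¬ @LE.le (E.superpose F) _ (Sum.inr a) (Sum.inl b) := by
  intro h
  obtain ⟨a', ha, -⟩ := superRel_inr E F h a rfl
  cases ha

theorem superpose_inl_le {E F : LabelledHeap P C} {a b : E} (h : a ≤ b) :
    @LE.le (E.superpose F) _ (Sum.inl a) (Sum.inl b) := .single (.left _ _ h)

theorem superpose_inr_le {E F : LabelledHeap P C} {a b : F} (h : a ≤ b) :
    @LE.le (E.superpose F) _ (Sum.inr a) (Sum.inr b) := .single (.right _ _ h)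

theorem superpose_cross_le {E F : LabelledHeap P C} {a : E} {b : F}
    (h : C.rel (E.label a) (F.label b)) :
    @LE.le (E.superpose F) _ (Sum.inl a) (Sum.inr b) := .single (.cross _ _ h)

/-- The empty heap. -/
def empty (P : Type u) (C : Concurrency P) : LabelledHeap P C where
  carrier := Empty
  fintype := inferInstance
  order := inferInstance
  label := Empty.elim
  comparable a := a.elim
  le_iff a := a.elim

/-- The heap with a single vertex labelled `p`. -/
def single (C : Concurrency P) (p : P) : LabelledHeap P C where
  carrier := Unit
  fintype := inferInstance
  order := inferInstance
  label := fun _ => p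
  comparable _ _ _ := Or.inl le_rfl
  le_iff _ _ := ⟨fun h => .single ⟨h, C.refl p⟩, fun _ => le_rfl⟩

theorem empty_superpose (E : LabelledHeap P C) : superpose (empty P C) E ≈ E := by
  refine equiv_of_monotone (E := superpose (empty P C) E) (Equiv.emptySum Empty E) ?_ ?_
  · rintro (a | a)
    · exact a.elim
    · rfl
  · rintro (a | a) (b | b) _ h
    · exact a.elim
    · exact a.elim
    · exact b.elim
    · exact superpose_le_of_inr h

theorem superpose_empty (E : LabelledHeap P C) : superpose E (empty P C) ≈ E := by
  refine equiv_of_monotone (E := superpose E (empty P C)) (Equiv.sumEmpty E Empty) ?_ ?_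
  · rintro (a | a)
    · rfl
    · exact a.elim
  · rintro (a | a) (b | b) _ h
    · exact superpose_le_of_inl h
    · exact b.elim
    · exact a.elim
    · exact a.elim

theorem superpose_assoc (E F G : LabelledHeap P C) :
    superpose (superpose E F) G ≈ superpose E (superpose F G) := by
  refine equiv_of_monotone (E := superpose (superpose E F) G)
    (F := superpose E (superpose F G)) (Equiv.sumAssoc E F G) ?_ ?_
  · rintro ((a | a) | a) <;> rfl
  · rintro ((a | a) | a) ((b | b) | b) hC h
    · exact superpose_inl_le (superpose_le_of_inl (superpose_le_of_inl h))
    · exact superpose_cross_le hC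
    · exact superpose_cross_le hC
    · exact (superpose_not_inr_le_inl (superpose_le_of_inl h)).elim
    · exact superpose_inr_le (superpose_inl_le (superpose_le_of_inr (superpose_le_of_inl h)))
    · exact superpose_inr_le (superpose_cross_le hC)
    · exact (superpose_not_inr_le_inl h).elim
    · exact (superpose_not_inr_le_inl h).elim
    · exact superpose_inr_le (superpose_inr_le (superpose_le_of_inr h))

theorem single_superpose_comm {p q : P} (h : ¬ C.rel p q) :
    superpose (single C p) (single C q) ≈ superpose (single C q) (single C p) := by
  refine equiv_of_monotone (E := superpose (single C p) (single C q))
    (F := superpose (single C q) (single C p)) (Equiv.sumComm Unit Unit) ?_ ?_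
  · rintro (a | a) <;> rfl
  · rintro (a | a) (b | b) hC _
    · exact superpose_inr_le le_rfl
    · exact (h hC).elim
    · exact (h (C.symm _ _ hC)).elim
    · exact superpose_inl_le le_rfl

theorem subheap_univ (E : LabelledHeap P C) : E.subheap Set.univ ≈ E :=
  equiv_of_monotone (E := E.subheap Set.univ) (Equiv.Set.univ E) (fun _ => rfl)
    (fun _ _ _ h => E.le_of_subheap_le h)

theorem subheap_empty (E : LabelledHeap P C) : E.subheap ∅ ≈ empty P C :=
  equiv_of_monotone (E := E.subheap ∅) (F := empty P C) (Equiv.equivOfIsEmpty (∅ : Set E) Empty)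
    (fun a => a.2.elim) (fun a => a.2.elim)

theorem subheap_singleton (E : LabelledHeap P C) (a : E) :
    E.subheap {a} ≈ single C (E.label a) := by
  refine equiv_of_monotone (E := E.subheap {a}) (F := single C (E.label a))
    ((Equiv.equivPUnit.{1} ({a} : Set E))) ?_ (fun _ _ _ _ => le_rfl)
  rintro ⟨b, rfl⟩
  rfl

/-- By `equiv_of_monotone` only concurrent pairs matter, and on those a subheap has the order of
`E`. The hypothesis supplies exactly the cross relations of the superposition. -/
theorem subheap_union (E : LabelledHeap P C) {S T : Set E} (hd : Disjoint S T)
    (h : ∀ a ∈ S, ∀ b ∈ T, C.rel (E.label a) (E.label b) → a ≤ b) :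
    E.subheap (S ∪ T) ≈ superpose (E.subheap S) (E.subheap T) := by
  classical
  refine Setoid.symm (equiv_of_monotone (E := superpose (E.subheap S) (E.subheap T))
    (F := E.subheap (S ∪ T)) (Equiv.Set.union hd).symm ?_ ?_)
  · rintro (a | a) <;> rfl
  · rintro (a | a) (b | b) hC hab
    · have h' := E.le_of_subheap_le (superpose_le_of_inl (a := a) (b := b) hab)
      exact E.subheap_le_of_le hC h'
    · exact E.subheap_le_of_le hC (h _ a.2 _ b.2 hC)
    · exact (superpose_not_inr_le_inl hab).elim
    · have h' := E.le_of_subheap_le (superpose_le_of_inr (a := a) (b := b) hab)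
      exact E.subheap_le_of_le hC h'

/-- The image in `E` of a labelled heap mapped injectively and compatibly. -/
theorem subheap_range {E F : LabelledHeap P C} (φ : F → E) (hφ : Function.Injective φ)
    (hl : ∀ a, E.label (φ a) = F.label a)
    (h : ∀ a b, C.rel (F.label a) (F.label b) → a ≤ b → φ a ≤ φ b) :
    E.subheap (Set.range φ) ≈ F := by
  refine Setoid.symm (equiv_of_monotone (F := E.subheap (Set.range φ))
    (Equiv.ofInjective φ hφ) hl ?_)
  intro a b hC hab
  refine E.subheap_le_of_le ?_ (h a b hC hab)
  change C.rel (E.label (φ a)) (E.label (φ b))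
  rw [hl, hl]; exact hC

/-- Converse of `subheap_union`: the two parts are the images of the two summands. It lets every
factorisation of heaps be studied inside one fixed labelled heap. -/
theorem exists_of_subheap_equiv_superpose {E A B : LabelledHeap P C} {S : Set E}
    (h : E.subheap S ≈ superpose A B) :
    ∃ S₁ S₂ : Set E, S = S₁ ∪ S₂ ∧ Disjoint S₁ S₂ ∧
      (∀ a ∈ S₁, ∀ b ∈ S₂, C.rel (E.label a) (E.label b) → a ≤ b) ∧
      E.subheap S₁ ≈ A ∧ E.subheap S₂ ≈ B := by
  obtain ⟨φ⟩ := Setoid.symm h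
  have hl : ∀ a, E.label (φ.1 a).1 = (superpose A B).label a := φ.2
  have hinj : ∀ a b, (φ.1 a).1 = (φ.1 b).1 → a = b := fun a b hab =>
    φ.1.injective (Subtype.ext hab)
  have hle : ∀ a b, a ≤ b → (φ.1 a).1 ≤ (φ.1 b).1 := fun a b hab =>
    E.le_of_subheap_le (φ.1.monotone hab)
  refine ⟨Set.range fun a : A => (φ.1 (Sum.inl a)).1,
    Set.range fun b : B => (φ.1 (Sum.inr b)).1, ?_, ?_, ?_, ?_, ?_⟩
  · ext v
    constructor
    · intro hv
      obtain ⟨w, hw⟩ := φ.1.surjective ⟨v, hv⟩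
      rcases w with w | w
      · exact Or.inl ⟨w, congrArg Subtype.val hw⟩
      · exact Or.inr ⟨w, congrArg Subtype.val hw⟩
    · rintro (⟨w, rfl⟩ | ⟨w, rfl⟩)
      · exact (φ.1 (Sum.inl w)).2
      · exact (φ.1 (Sum.inr w)).2
  · rw [Set.disjoint_left]
    rintro _ ⟨a, rfl⟩ ⟨b, hb⟩
    have := hinj _ _ hb
    cases this
  · rintro _ ⟨a, rfl⟩ _ ⟨b, rfl⟩ hC
    dsimp only at hC
    rw [hl (Sum.inl a), hl (Sum.inr b)] at hC
    exact hle _ _ (superpose_cross_le hC)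
  · exact subheap_range _ (fun a b hab => Sum.inl_injective (hinj _ _ hab)) (fun a => hl _)
      (fun a b _ hab => hle _ _ (superpose_inl_le hab))
  · exact subheap_range _ (fun a b hab => Sum.inr_injective (hinj _ _ hab)) (fun a => hl _)
      (fun a b _ hab => hle _ _ (superpose_inr_le hab))

end LabelledHeap

/-! ### The monoid of heaps -/

namespace Heap

theorem mk_eq {E F : LabelledHeap P C} : mk E = mk F ↔ E ≈ F := Quotient.eq

theorem exists_mk (h : Heap P C) : ∃ E : LabelledHeap P C, mk E = h := Quotient.exists_rep h

/-- Heaps form a monoid under superposition. -/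
instance : Monoid (Heap P C) where
  mul := superpose
  one := mk (LabelledHeap.empty P C)
  mul_assoc a b c := by
    obtain ⟨a, rfl⟩ := exists_mk a
    obtain ⟨b, rfl⟩ := exists_mk b
    obtain ⟨c, rfl⟩ := exists_mk c
    exact Quotient.sound (LabelledHeap.superpose_assoc a b c)
  one_mul a := by
    obtain ⟨a, rfl⟩ := exists_mk a
    exact Quotient.sound (LabelledHeap.empty_superpose a)
  mul_one a := by
    obtain ⟨a, rfl⟩ := exists_mk a
    exact Quotient.sound (LabelledHeap.superpose_empty a)

theorem mk_mul_mk (E F : LabelledHeap P C) : mk E * mk F = mk (E.superpose F) := rfl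

/-- The heap with a single vertex labelled `p`. -/
def single (C : Concurrency P) (p : P) : Heap P C := mk (LabelledHeap.single C p)

theorem single_comm {p q : P} (h : ¬ C.rel p q) :
    single C p * single C q = single C q * single C p :=
  Quotient.sound (LabelledHeap.single_superpose_comm h)

/-- The heap of the subheap on `S`. -/
noncomputable def sub (E : LabelledHeap P C) (S : Set E) : Heap P C := mk (E.subheap S)

theorem sub_univ (E : LabelledHeap P C) : sub E Set.univ = mk E :=
  mk_eq.2 E.subheap_univ

theorem sub_empty (E : LabelledHeap P C) : sub E ∅ = 1 := mk_eq.2 E.subheap_empty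

theorem sub_singleton (E : LabelledHeap P C) (a : E) : sub E {a} = single C (E.label a) :=
  mk_eq.2 (E.subheap_singleton a)

theorem sub_union (E : LabelledHeap P C) {S T : Set E} (hd : Disjoint S T)
    (h : ∀ a ∈ S, ∀ b ∈ T, C.rel (E.label a) (E.label b) → a ≤ b) :
    sub E (S ∪ T) = sub E S * sub E T := mk_eq.2 (E.subheap_union hd h)

theorem exists_of_sub_eq_mul {E : LabelledHeap P C} {S : Set E} {a b : Heap P C}
    (h : sub E S = a * b) :
    ∃ S₁ S₂ : Set E, S = S₁ ∪ S₂ ∧ Disjoint S₁ S₂ ∧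
      (∀ a ∈ S₁, ∀ b ∈ S₂, C.rel (E.label a) (E.label b) → a ≤ b) ∧
      sub E S₁ = a ∧ sub E S₂ = b := by
  obtain ⟨a, rfl⟩ := exists_mk a
  obtain ⟨b, rfl⟩ := exists_mk b
  obtain ⟨S₁, S₂, h₁, h₂, h₃, h₄, h₅⟩ :=
    LabelledHeap.exists_of_subheap_equiv_superpose (mk_eq.1 h)
  exact ⟨S₁, S₂, h₁, h₂, h₃, mk_eq.2 h₄, mk_eq.2 h₅⟩

theorem exists_of_sub_eq_single {E : LabelledHeap P C} {S : Set E} {p : P}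
    (h : sub E S = single C p) : ∃ a, S = {a} ∧ E.label a = p := by
  obtain ⟨φ⟩ := mk_eq.1 h
  have hu : ∀ a : E.subheap S, φ.1 a = () := fun _ => rfl
  refine ⟨(φ.1.symm ()).1, ?_, ?_⟩
  · ext v
    rw [Set.mem_singleton_iff]
    constructor
    · intro hv
      have : φ.1.symm () = ⟨v, hv⟩ := φ.1.symm_apply_apply ⟨v, hv⟩
      rw [this]
    · rintro rfl
      exact (φ.1.symm ()).2
  · exact (φ.2 (φ.1.symm ())).symm

/-- Every heap is obtained from the empty heap by successively adding vertices at the bottom. -/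
theorem sub_induction {E : LabelledHeap P C} {motive : Set E → Prop} (h0 : motive ∅)
    (h1 : ∀ a S, a ∉ S → (∀ b ∈ S, C.rel (E.label a) (E.label b) → a ≤ b) → motive S →
      motive (insert a S)) : motive Set.univ := by
  classical
  -- The induction runs over up-closed sets: they stay up-closed when a minimal vertex is removed.
  suffices h : ∀ S : Finset E, (∀ a ∈ S, ∀ b, a ≤ b → b ∈ S) → motive (S : Set E) by
    simpa using h Finset.univ (by simp)
  intro S
  induction S using Finset.strongInduction with
  | H S ih =>
    intro hS
    rcases S.eq_empty_or_nonempty with rfl | hne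
    · simpa using h0
    · obtain ⟨a, haS, ha⟩ := S.exists_minimal hne
      rw [← Finset.insert_erase haS, Finset.coe_insert]
      refine h1 a _ (by simp) ?_ (ih _ (Finset.erase_ssubset haS) ?_)
      · intro b hb hC
        rcases E.comparable a b hC with h | h
        · exact h
        · exact ha (Finset.mem_of_mem_erase (Finset.mem_coe.1 hb)) h
      · intro c hc b hcb
        rw [Finset.mem_erase] at hc ⊢
        refine ⟨?_, hS c hc.2 b hcb⟩
        rintro rfl
        exact hc.1 (le_antisymm hcb (ha hc.2 hcb))

theorem sub_insert {E : LabelledHeap P C} {a : E} {S : Set E} (ha : a ∉ S)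
    (h : ∀ b ∈ S, C.rel (E.label a) (E.label b) → a ≤ b) :
    sub E (insert a S) = single C (E.label a) * sub E S := by
  rw [Set.insert_eq, sub_union E (by simpa using ha) (by simpa using h), sub_singleton]

@[elab_as_elim]
theorem induction_left {motive : Heap P C → Prop} (h : Heap P C) (one : motive 1)
    (mul : ∀ p x, motive x → motive (single C p * x)) : motive h := by
  obtain ⟨E, rfl⟩ := exists_mk h
  rw [← sub_univ]
  refine sub_induction (motive := fun S => motive (sub E S)) ?_ ?_
  · rw [sub_empty]; exact one
  · intro a S ha hb ih
    rw [sub_insert ha hb]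
    exact mul _ _ ih

/-! ### Comparison with the commutation monoid -/

/-- The homomorphism from the commutation monoid to heaps. -/
noncomputable def ofCo (C : Concurrency P) : Co C →* Heap P C :=
  (conGen (CommRel C)).lift (FreeMonoid.lift (single C)) (by
    rw [Con.conGen_le]
    rintro _ _ ⟨p, q, h⟩
    simpa [Con.ker_rel] using single_comm h)

/-- Replaces the arbitrarily chosen natural labelling in the definition of `toCo` by any convenient
linear order. -/
theorem toCo_mk (E : LabelledHeap P C) (l : List E) (hn : l.Nodup) (hm : ∀ a, a ∈ l)
    (hl : l.Pairwise (fun a b => ¬ b < a)) : (mk E).toCo = Co.word C (l.map E.label) := by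
  change Co.word C E.nonempty_naturalLabelling.some.word = _
  set π := E.nonempty_naturalLabelling.some
  have h₁ : π.word = (List.ofFn (fun i => π.toEquiv.symm i)).map E.label := by
    rw [List.map_ofFn]
    rfl
  have n₁ : (List.ofFn (fun i => π.toEquiv.symm i)).Nodup :=
    List.nodup_ofFn.2 π.toEquiv.symm.injective
  rw [h₁]
  refine E.word_eq_of_perm _ _ n₁ ((List.perm_ext_iff_of_nodup n₁ hn).2 fun a => ?_) ?_ hl
  · simp only [List.mem_ofFn, hm, iff_true]
    exact ⟨π.toEquiv a, by simp⟩
  · rw [List.pairwise_ofFn]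
    intro i j hij hlt
    have := π.strictMono _ _ hlt
    simp only [Equiv.apply_symm_apply] at this
    exact lt_asymm hij this

theorem exists_linear_list (E : LabelledHeap P C) :
    ∃ l : List E, l.Nodup ∧ (∀ a, a ∈ l) ∧ l.Pairwise (fun a b => ¬ b < a) := by
  obtain ⟨π⟩ := E.nonempty_naturalLabelling
  refine ⟨List.ofFn (fun i => π.toEquiv.symm i), List.nodup_ofFn.2 π.toEquiv.symm.injective,
    fun a => List.mem_ofFn.2 ⟨π.toEquiv a, by simp⟩, ?_⟩
  rw [List.pairwise_ofFn]
  intro i j hij hlt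
  have := π.strictMono _ _ hlt
  simp only [Equiv.apply_symm_apply] at this
  exact lt_asymm hij this

theorem toCo_one : (1 : Heap P C).toCo = 1 :=
  toCo_mk (LabelledHeap.empty P C) [] List.nodup_nil (fun a => a.elim) List.Pairwise.nil

theorem toCo_single (p : P) : (single C p).toCo = Co.word C [p] :=
  toCo_mk (LabelledHeap.single C p) [()] (List.nodup_singleton _) (fun _ => List.mem_singleton.2 rfl)
    (List.pairwise_singleton _ _)

theorem toCo_mul (a b : Heap P C) : (a * b).toCo = a.toCo * b.toCo := by
  obtain ⟨E, rfl⟩ := exists_mk a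
  obtain ⟨F, rfl⟩ := exists_mk b
  obtain ⟨l, hn, hm, hl⟩ := exists_linear_list E
  obtain ⟨l', hn', hm', hl'⟩ := exists_linear_list F
  rw [mk_mul_mk, toCo_mk E l hn hm hl, toCo_mk F l' hn' hm' hl',
    toCo_mk (E.superpose F) (l.map Sum.inl ++ l'.map Sum.inr), ← LabelledHeap.Co.word_append]
  · change Co.word C (List.map (Sum.elim E.label F.label) (l.map Sum.inl ++ l'.map Sum.inr)) = _
    rw [List.map_append, List.map_map, List.map_map]
    rfl
  · refine List.nodup_append'.2 ⟨hn.map Sum.inl_injective, hn'.map Sum.inr_injective, ?_⟩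
    intro x hx hx'
    obtain ⟨a, -, rfl⟩ := List.mem_map.1 hx
    obtain ⟨b, -, hb⟩ := List.mem_map.1 hx'
    cases hb
  · rintro (a | a)
    · exact List.mem_append_left _ (List.mem_map_of_mem (hm a))
    · exact List.mem_append_right _ (List.mem_map_of_mem (hm' a))
  · refine List.pairwise_append.2
      ⟨List.pairwise_map.2 (hl.imp ?_), List.pairwise_map.2 (hl'.imp ?_), ?_⟩
    · intro a b h hlt
      exact h (lt_of_le_not_ge (LabelledHeap.superpose_le_of_inl hlt.le)
        fun h' => hlt.not_ge (LabelledHeap.superpose_inl_le h'))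
    · intro a b h hlt
      exact h (lt_of_le_not_ge (LabelledHeap.superpose_le_of_inr hlt.le)
        fun h' => hlt.not_ge (LabelledHeap.superpose_inr_le h'))
    · intro x hx y hy hlt
      obtain ⟨a, -, rfl⟩ := List.mem_map.1 hx
      obtain ⟨b, -, rfl⟩ := List.mem_map.1 hy
      exact LabelledHeap.superpose_not_inr_le_inl hlt.le

theorem ofCo_toCo (h : Heap P C) : ofCo C h.toCo = h := by
  induction h using induction_left with
  | one => rw [toCo_one, map_one]
  | mul p x ih =>
    rw [toCo_mul, map_mul, ih, toCo_single]
    congr 1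

/-- With `ofCo_toCo` this identifies heaps with words modulo commutation. Here every monoid element
is seen to be a heap, which spanning needs; `ofCo_toCo` is what transfers the action on heaps to the
monoid algebra. -/
theorem toCo_ofCo (x : Co C) : (ofCo C x).toCo = x := by
  induction x using Con.induction_on with
  | H w =>
    induction w using FreeMonoid.recOn with
    | one => exact toCo_one
    | of_mul p w ih =>
      rw [Con.coe_mul, map_mul, toCo_mul, ih]
      congr 1

/-! ### Factorisations of heaps as level functions -/

/-- `f` is monotone on concurrent pairs of elements of `S`. -/
def IsLevel (E : LabelledHeap P C) (S : Set E) (f : E → ℕ) : Prop :=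
  ∀ u ∈ S, ∀ v ∈ S, C.rel (E.label u) (E.label v) → u ≤ v → f u ≤ f v

theorem IsLevel.mono {E : LabelledHeap P C} {S S' : Set E} {f : E → ℕ} (h : IsLevel E S f)
    (hS : S' ⊆ S) : IsLevel E S' f := fun u hu v hv => h u (hS hu) v (hS hv)

/-- Concurrent vertices are comparable and the reverse order would contradict monotonicity of `f`.
Cutting at a level therefore satisfies the hypothesis of `sub_union`. -/
theorem IsLevel.le_of_lt {E : LabelledHeap P C} {S : Set E} {f : E → ℕ} (h : IsLevel E S f)
    {u v : E} (hu : u ∈ S) (hv : v ∈ S) (hC : C.rel (E.label u) (E.label v)) (hf : f u < f v) :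
    u ≤ v := by
  rcases E.comparable u v hC with h' | h'
  · exact h'
  · exact absurd (h v hv u hu (C.symm _ _ hC) h') (not_le.2 hf)

theorem IsLevel.sub_split {E : LabelledHeap P C} {S : Set E} {f : E → ℕ} (h : IsLevel E S f)
    (n : ℕ) : sub E S = sub E {v ∈ S | f v < n} * sub E {v ∈ S | n ≤ f v} := by
  rw [← sub_union]
  · congr 1
    ext v
    simp only [Set.mem_union, Set.mem_ofPred_eq, ← and_or_left, lt_or_ge, and_true]
  · rw [Set.disjoint_left]
    rintro v ⟨-, h1⟩ ⟨-, h2⟩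
    exact absurd h1 (not_lt.2 h2)
  · rintro u ⟨hu, h1⟩ v ⟨hv, h2⟩ hC
    exact h.le_of_lt hu hv hC (h1.trans_le h2)

theorem eq_empty_of_sub_eq_one {E : LabelledHeap P C} {S : Set E} (h : sub E S = 1) : S = ∅ := by
  obtain ⟨φ⟩ := mk_eq.1 h
  ext v
  simp only [Set.mem_empty_iff_false, iff_false]
  intro hv
  exact (φ.1 ⟨v, hv⟩ : Empty).elim

/-- Iterating `exists_of_sub_eq_mul` peels off one factor at a time: the vertices of the first
factor get level 0 and the levels of the others shift by one. -/
theorem exists_levels {E : LabelledHeap P C} (L : List (Heap P C)) (S : Set E)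
    (h : sub E S = L.prod) : ∃ f : E → ℕ, IsLevel E S f ∧ (∀ v ∈ S, f v < L.length) ∧
      ∀ i (hi : i < L.length), sub E {v ∈ S | f v = i} = L[i] := by
  classical
  induction L generalizing S with
  | nil =>
    obtain rfl := eq_empty_of_sub_eq_one h
    exact ⟨fun _ => 0, fun u hu => hu.elim, fun u hu => hu.elim, fun i hi => absurd hi (by simp)⟩
  | cons a L ih =>
    rw [List.prod_cons] at h
    obtain ⟨S₁, S₂, rfl, hd, hle, h₁, h₂⟩ := exists_of_sub_eq_mul h
    obtain ⟨f, hf, hb, hs⟩ := ih S₂ h₂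
    have hn : ∀ v ∈ S₂, v ∉ S₁ := fun v hv hv' => Set.disjoint_left.1 hd hv' hv
    refine ⟨fun v => if v ∈ S₁ then 0 else f v + 1, ?_, ?_, ?_⟩
    · intro u hu v hv hC huv
      by_cases hu1 : u ∈ S₁
      · simp [hu1]
      · have hu2 := hu.resolve_left hu1
        by_cases hv1 : v ∈ S₁
        · have := hle v hv1 u hu2 (C.symm _ _ hC)
          obtain rfl := le_antisymm huv this
          exact absurd hv1 hu1
        · simpa [hu1, hv1] using hf u hu2 v (hv.resolve_left hv1) hC huv
    · rintro v (hv | hv)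
      · simp [hv]
      · simpa [hn v hv] using hb v hv
    · rintro (_ | i) hi
      · rw [List.getElem_cons_zero, ← h₁]
        congr 1
        ext v
        by_cases hv : v ∈ S₁ <;> simp [hv]
      · rw [List.getElem_cons_succ, ← hs i (by simpa using hi)]
        congr 1
        ext v
        by_cases hv : v ∈ S₁
        · have : v ∉ S₂ := fun h => hn v h hv
          simp [hv, this]
        · simp [hv]

/-! ### Reduction steps and redexes -/

/-- `m` may be deleted from `s m s`, producing the factor `δ ^ i`. -/
def IsMiddle (s : P) (m : Heap P C) (i : ℕ) : Prop :=
  (m = 1 ∧ i = 1) ∨ ∃ t, t ≠ s ∧ C.rel s t ∧ m = single C t ∧ i = 0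

/-- One step reduction `s s → δ s` or `s t s → s`. -/
inductive Red : ℕ → Heap P C → Heap P C → Prop
  | intro (a : Heap P C) (s : P) (m b : Heap P C) (i : ℕ) : IsMiddle s m i →
      Red i (a * (single C s * (m * (single C s * b)))) (a * (single C s * b))

theorem Red.mul_left {i : ℕ} {x y : Heap P C} (h : Red i x y) (c : Heap P C) :
    Red i (c * x) (c * y) := by
  obtain ⟨a, s, m, b, i, hm⟩ := h
  rw [← mul_assoc, ← mul_assoc c]
  exact .intro _ _ _ _ _ hm

theorem Red.mul_right {i : ℕ} {x y : Heap P C} (h : Red i x y) (c : Heap P C) :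
    Red i (x * c) (y * c) := by
  obtain ⟨a, s, m, b, i, hm⟩ := h
  simp only [mul_assoc]
  exact .intro _ _ _ _ _ hm

/-- The elements `x` and `z` enclose `T` in the subheap on `S`, witnessed by the level function
`f`, and the labels of `x`, `T`, `z` can be reduced. -/
structure IsRedex (E : LabelledHeap P C) (S : Set E) (f : E → ℕ) (x z : E) (T : Set E) (i : ℕ) :
    Prop where
  level : IsLevel E S f
  x_mem : x ∈ S
  z_mem : z ∈ S
  fx : ∀ v ∈ S, f v = 1 ↔ v = x
  fz : ∀ v ∈ S, f v = 3 ↔ v = z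
  fT : ∀ v, v ∈ T ↔ v ∈ S ∧ f v = 2
  label_eq : E.label x = E.label z
  middle : IsMiddle (E.label x) (sub E T) i

namespace IsRedex

variable {E : LabelledHeap P C} {S : Set E} {f : E → ℕ} {x z : E} {T : Set E} {i : ℕ}

theorem f_x (h : IsRedex E S f x z T i) : f x = 1 := (h.fx x h.x_mem).2 rfl

theorem f_z (h : IsRedex E S f x z T i) : f z = 3 := (h.fz z h.z_mem).2 rfl

theorem ne (h : IsRedex E S f x z T i) : x ≠ z := by
  intro hxz
  have := h.f_x
  rw [hxz, h.f_z] at this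
  omega

theorem sub_eq (h : IsRedex E S f x z T i) :
    sub E S = sub E {v ∈ S | f v < 1} * (single C (E.label x) * (sub E T *
      (single C (E.label x) * sub E {v ∈ S | 3 < f v}))) := by
  have l₁ : IsLevel E {v ∈ S | 1 ≤ f v} f := h.level.mono (Set.sep_subset _ _)
  have l₂ : IsLevel E {v ∈ {v ∈ S | 1 ≤ f v} | 2 ≤ f v} f := l₁.mono (Set.sep_subset _ _)
  have l₃ : IsLevel E {v ∈ {v ∈ {v ∈ S | 1 ≤ f v} | 2 ≤ f v} | 3 ≤ f v} f :=
    l₂.mono (Set.sep_subset _ _)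
  rw [h.level.sub_split 1, l₁.sub_split 2, l₂.sub_split 3, l₃.sub_split 4]
  refine congrArg₂ _ rfl (congrArg₂ _ ?_ (congrArg₂ _ ?_ (congrArg₂ _ ?_ ?_)))
  · rw [← sub_singleton]
    congr 1
    ext v
    simp only [Set.mem_ofPred_eq, Set.mem_singleton_iff]
    constructor
    · rintro ⟨⟨hv, h1⟩, h2⟩
      exact (h.fx v hv).1 (by omega)
    · rintro rfl
      refine ⟨⟨h.x_mem, ?_⟩, ?_⟩ <;> rw [h.f_x]
      omega
  · congr 1
    ext v
    simp only [Set.mem_ofPred_eq, h.fT]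
    constructor
    · rintro ⟨⟨⟨hv, h1⟩, h2⟩, h3⟩
      exact ⟨hv, by omega⟩
    · rintro ⟨hv, h2⟩
      exact ⟨⟨⟨hv, by omega⟩, by omega⟩, by omega⟩
  · rw [h.label_eq, ← sub_singleton]
    congr 1
    ext v
    simp only [Set.mem_ofPred_eq, Set.mem_singleton_iff]
    constructor
    · rintro ⟨⟨⟨⟨hv, h1⟩, h2⟩, h3⟩, h4⟩
      exact (h.fz v hv).1 (by omega)
    · rintro rfl
      have := h.f_z
      exact ⟨⟨⟨⟨h.z_mem, by omega⟩, by omega⟩, by omega⟩, by omega⟩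
  · congr 1
    ext v
    simp only [Set.mem_ofPred_eq]
    constructor
    · rintro ⟨⟨⟨⟨hv, h1⟩, h2⟩, h3⟩, h4⟩
      exact ⟨hv, by omega⟩
    · rintro ⟨hv, h1⟩
      exact ⟨⟨⟨⟨hv, by omega⟩, by omega⟩, by omega⟩, by omega⟩

/-- The vertex `c` is whichever of `x` and `z` survives. Both have the same label, so deleting `T`
with either of them leaves the same heap. -/
theorem sub_remove_aux (h : IsRedex E S f x z T i) {S' : Set E} {c : E}
    (hS : ∀ v, v ∈ S' ↔ v ∈ S ∧ (f v < 1 ∨ v = c ∨ 3 < f v)) (hcS : c ∈ S)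
    (hc1 : 1 ≤ f c) (hc3 : f c ≤ 3) (hl : E.label c = E.label x) :
    sub E S' = sub E {v ∈ S | f v < 1} *
      (single C (E.label x) * sub E {v ∈ S | 3 < f v}) := by
  have hsub : S' ⊆ S := fun v hv => ((hS v).1 hv).1
  have l₁ : IsLevel E {v ∈ S' | 1 ≤ f v} f := (h.level.mono hsub).mono (Set.sep_subset _ _)
  rw [(h.level.mono hsub).sub_split 1, l₁.sub_split 4, ← hl, ← sub_singleton]
  refine congrArg₂ _ ?_ (congrArg₂ _ ?_ ?_)
  · congr 1
    ext v
    simp only [Set.mem_ofPred_eq, hS]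
    constructor
    · rintro ⟨⟨hv, h1⟩, h2⟩
      exact ⟨hv, h2⟩
    · rintro ⟨hv, h1⟩
      exact ⟨⟨hv, Or.inl h1⟩, h1⟩
  · congr 1
    ext v
    simp only [Set.mem_ofPred_eq, hS, Set.mem_singleton_iff]
    constructor
    · rintro ⟨⟨⟨hv, h1⟩, h2⟩, h3⟩
      rcases h1 with h1 | h1 | h1
      · omega
      · exact h1
      · omega
    · rintro rfl
      exact ⟨⟨⟨hcS, Or.inr (Or.inl rfl)⟩, hc1⟩, by omega⟩
  · congr 1
    ext v
    simp only [Set.mem_ofPred_eq, hS]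
    constructor
    · rintro ⟨⟨⟨hv, h1⟩, h2⟩, h3⟩
      exact ⟨hv, by omega⟩
    · rintro ⟨hv, h1⟩
      exact ⟨⟨⟨hv, Or.inr (Or.inr h1)⟩, by omega⟩, by omega⟩

theorem sub_remove_right (h : IsRedex E S f x z T i) :
    sub E (S \ (T ∪ {z})) = sub E {v ∈ S | f v < 1} *
      (single C (E.label x) * sub E {v ∈ S | 3 < f v}) := by
  refine h.sub_remove_aux (c := x) (fun v => ?_) h.x_mem h.f_x.ge (by rw [h.f_x]; omega) rfl
  simp only [Set.mem_sdiff, Set.mem_union, Set.mem_singleton_iff, h.fT, not_or, not_and]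
  refine and_congr_right fun hv => ?_
  have e1 := h.fx v hv
  have e3 := h.fz v hv
  constructor
  · rintro ⟨h1, h2⟩
    have := h1 hv
    rw [← e3] at h2
    rw [← e1]
    omega
  · intro h1
    rw [← e1] at h1
    rw [← e3]
    exact ⟨fun _ => by omega, by omega⟩

theorem sub_remove_left (h : IsRedex E S f x z T i) :
    sub E (S \ (T ∪ {x})) = sub E {v ∈ S | f v < 1} *
      (single C (E.label x) * sub E {v ∈ S | 3 < f v}) := by
  refine h.sub_remove_aux (c := z) (fun v => ?_) h.z_mem (by rw [h.f_z]; omega) h.f_z.le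
    h.label_eq.symm
  simp only [Set.mem_sdiff, Set.mem_union, Set.mem_singleton_iff, h.fT, not_or, not_and]
  refine and_congr_right fun hv => ?_
  have e1 := h.fx v hv
  have e3 := h.fz v hv
  constructor
  · rintro ⟨h1, h2⟩
    have := h1 hv
    rw [← e1] at h2
    rw [← e3]
    omega
  · intro h1
    rw [← e3] at h1
    rw [← e1]
    exact ⟨fun _ => by omega, by omega⟩

theorem restrict (h : IsRedex E S f x z T i) {S' : Set E} (hS : S' ⊆ S) (hx : x ∈ S')
    (hz : z ∈ S') (hT : T ⊆ S') : IsRedex E S' f x z T i where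
  level := h.level.mono hS
  x_mem := hx
  z_mem := hz
  fx v hv := h.fx v (hS hv)
  fz v hv := h.fz v (hS hv)
  fT v := ⟨fun hv => ⟨hT hv, ((h.fT v).1 hv).2⟩, fun hv => (h.fT v).2 ⟨hS hv.1, hv.2⟩⟩
  label_eq := h.label_eq
  middle := h.middle

/-- Once its middle has been deleted by another reduction, a redex becomes a square `s s`, hence the
index 1 whatever `i` was. -/
theorem restrict_empty (h : IsRedex E S f x z T i) {S' : Set E} (hS : S' ⊆ S) (hx : x ∈ S')
    (hz : z ∈ S') (hT : Disjoint T S') : IsRedex E S' f x z ∅ 1 where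
  level := h.level.mono hS
  x_mem := hx
  z_mem := hz
  fx v hv := h.fx v (hS hv)
  fz v hv := h.fz v (hS hv)
  fT v := ⟨fun hv => hv.elim, fun hv =>
    (Set.disjoint_left.1 hT ((h.fT v).2 ⟨hS hv.1, hv.2⟩) hv.1).elim⟩
  label_eq := h.label_eq
  middle := Or.inl ⟨sub_empty E, rfl⟩

theorem red (h : IsRedex E S f x z T i) {D : Set E} (hD : D = T ∪ {x} ∨ D = T ∪ {z}) :
    Red i (sub E S) (sub E (S \ D)) := by
  have : sub E (S \ D) = sub E {v ∈ S | f v < 1} *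
      (single C (E.label x) * sub E {v ∈ S | 3 < f v}) := by
    rcases hD with rfl | rfl
    · exact h.sub_remove_left
    · exact h.sub_remove_right
  rw [this, h.sub_eq]
  exact .intro _ _ _ _ _ h.middle

theorem middle_cases (h : IsRedex E S f x z T i) : (T = ∅ ∧ i = 1) ∨
    ∃ y, T = {y} ∧ i = 0 ∧ E.label y ≠ E.label x ∧ C.rel (E.label x) (E.label y) := by
  rcases h.middle with ⟨h1, h2⟩ | ⟨t, h1, h2, h3, h4⟩
  · exact Or.inl ⟨eq_empty_of_sub_eq_one h1, h2⟩
  · obtain ⟨y, hy, rfl⟩ := exists_of_sub_eq_single h3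
    exact Or.inr ⟨y, hy, h4, h1, h2⟩

end IsRedex

/-- The five factors of a reducible heap give levels 0 to 4. The result is described by both choices
of deleted vertices, a freedom on which local confluence relies. -/
theorem Red.exists_isRedex {i : ℕ} {E : LabelledHeap P C} {S : Set E} {h' : Heap P C}
    (h : Red i (sub E S) h') : ∃ f x z T, IsRedex E S f x z T i ∧
      ∀ D, D = T ∪ {x} ∨ D = T ∪ {z} → h' = sub E (S \ D) := by
  generalize hh : sub E S = h₀ at h
  obtain ⟨a, s, m, b, i, hm⟩ := h
  obtain ⟨f, hf, hb, hs⟩ := exists_levels [a, single C s, m, single C s, b] S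
    (by simpa using hh)
  have h0 := hs 0 (by simp)
  obtain ⟨x, hx, hxl⟩ := exists_of_sub_eq_single (hs 1 (by simp))
  have h2 := hs 2 (by simp)
  obtain ⟨z, hz, hzl⟩ := exists_of_sub_eq_single (hs 3 (by simp))
  have h4 := hs 4 (by simp)
  simp only [List.getElem_cons_zero, List.getElem_cons_succ] at h0 h2 h4
  have hx' : ∀ v, v ∈ S ∧ f v = 1 ↔ v = x := fun v => by
    simpa using Set.ext_iff.1 hx v
  have hz' : ∀ v, v ∈ S ∧ f v = 3 ↔ v = z := fun v => by
    simpa using Set.ext_iff.1 hz v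
  have hR : IsRedex E S f x z {v ∈ S | f v = 2} i :=
    { level := hf
      x_mem := ((hx' x).2 rfl).1
      z_mem := ((hz' z).2 rfl).1
      fx := fun v hv => by rw [← hx']; simp [hv]
      fz := fun v hv => by rw [← hz']; simp [hv]
      fT := fun v => Iff.rfl
      label_eq := by rw [hxl, hzl]
      middle := by rw [hxl, h2]; exact hm }
  refine ⟨f, x, z, _, hR, ?_⟩
  have e0 : {v ∈ S | f v < 1} = {v ∈ S | f v = 0} := by simp
  have e4 : {v ∈ S | 3 < f v} = {v ∈ S | f v = 4} := by
    ext v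
    simp only [Set.mem_ofPred_eq]
    refine and_congr_right fun hv => ?_
    have := hb v hv
    simp only [List.length_cons, List.length_nil] at this
    omega
  rintro D (rfl | rfl)
  · rw [hR.sub_remove_left, e0, e4, h0, h4, hxl]
  · rw [hR.sub_remove_right, e0, e4, h0, h4, hxl]

/-! ### Overlaps of redexes and local confluence -/

/-- A comparison in `E` is a chain of concurrent ones. The chain may leave a proper subset, so
redexes are compared only on `Set.univ`. -/
theorem IsLevel.monotone {E : LabelledHeap P C} {f : E → ℕ} (h : IsLevel E Set.univ f) {u v : E}
    (huv : u ≤ v) : f u ≤ f v := by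
  have h' := (E.le_iff u v).1 huv
  induction h' with
  | single h' => exact h _ trivial _ trivial h'.2 h'.1
  | tail h₁ h₂ ih =>
    exact (ih ((E.le_iff _ _).2 h₁)).trans (h _ trivial _ trivial h₂.2 h₂.1)

namespace IsRedex

variable {E : LabelledHeap P C} {f f' : E → ℕ} {x z x' z' : E} {T T' : Set E} {i i' : ℕ}

theorem lt (h : IsRedex E Set.univ f x z T i) : x < z := by
  refine lt_of_le_of_ne (h.level.le_of_lt trivial trivial ?_ ?_) h.ne
  · rw [h.label_eq]; exact C.refl _
  · rw [h.f_x, h.f_z]; omega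

theorem between (h : IsRedex E Set.univ f x z T i) {w : E} (h₁ : x ≤ w) (h₂ : w ≤ z) :
    w = x ∨ w = z ∨ w ∈ T := by
  have e1 := h.level.monotone h₁
  have e2 := h.level.monotone h₂
  rw [h.f_x] at e1
  rw [h.f_z] at e2
  rw [← h.fx w trivial, ← h.fz w trivial, h.fT]
  simp only [Set.mem_univ, true_and]
  omega

theorem of_mem (h : IsRedex E Set.univ f x z T i) {y : E} (hy : y ∈ T) :
    T = {y} ∧ i = 0 ∧ x < y ∧ y < z ∧ E.label y ≠ E.label x ∧
      C.rel (E.label x) (E.label y) := by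
  have hf := ((h.fT y).1 hy).2
  rcases h.middle_cases with ⟨rfl, -⟩ | ⟨y', rfl, hi, hl, hC⟩
  · exact hy.elim
  · obtain rfl := hy
    refine ⟨rfl, hi, lt_of_le_of_ne (h.level.le_of_lt trivial trivial hC ?_) ?_,
      lt_of_le_of_ne (h.level.le_of_lt trivial trivial ?_ ?_) ?_, hl, hC⟩
    · rw [hf, h.f_x]; omega
    · rintro rfl; exact hl rfl
    · rw [← h.label_eq]; exact C.symm _ _ hC
    · rw [hf, h.f_z]; omega
    · rintro rfl; exact hl h.label_eq.symm

theorem index_eq (h : IsRedex E Set.univ f x z T i) (h' : IsRedex E Set.univ f' x' z' T i') :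
    i = i' := by
  rcases h.middle_cases with ⟨h1, h2⟩ | ⟨y, h1, h2, -⟩ <;>
  rcases h'.middle_cases with ⟨h1', h2'⟩ | ⟨y', h1', h2', -⟩
  · rw [h2, h2']
  · rw [h1] at h1'
    exact (Set.singleton_ne_empty _ h1'.symm).elim
  · rw [h1] at h1'
    exact (Set.singleton_ne_empty _ h1').elim
  · rw [h2, h2']

theorem T_subset (h : IsRedex E Set.univ f x z T i) (h' : IsRedex E Set.univ f' x z T' i') :
    T ⊆ T' := by
  intro y hy
  obtain ⟨-, -, h1, h2, -⟩ := h.of_mem hy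
  rcases h'.between h1.le h2.le with rfl | rfl | h3
  · exact (lt_irrefl _ h1).elim
  · exact (lt_irrefl _ h2).elim
  · exact h3

theorem T_eq (h : IsRedex E Set.univ f x z T i) (h' : IsRedex E Set.univ f' x z T' i') :
    T = T' := (h.T_subset h').antisymm (h'.T_subset h)

/-- The nearer of the two right ends would lie strictly between `x` and the other, hence in a
middle, but a middle vertex never has the label of `x`. -/
theorem right_unique (h : IsRedex E Set.univ f x z T i) (h' : IsRedex E Set.univ f' x z' T' i') :
    z = z' := by
  have key : ∀ {g g' : E → ℕ} {w w' : E} {U U' : Set E} {j j' : ℕ},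
      IsRedex E Set.univ g x w U j → IsRedex E Set.univ g' x w' U' j' → w ≤ w' → w = w' := by
    intro g g' w w' U U' j j' h h' hw
    rcases h'.between h.lt.le hw with rfl | rfl | hm
    · exact (lt_irrefl _ h.lt).elim
    · rfl
    · exact ((h'.of_mem hm).2.2.2.2.1 h.label_eq.symm).elim
  rcases E.comparable z z' (by rw [← h.label_eq, ← h'.label_eq]; exact C.refl _) with hz | hz
  · exact key h h' hz
  · exact (key h' h hz).symm

theorem left_unique (h : IsRedex E Set.univ f x z T i) (h' : IsRedex E Set.univ f' x' z T' i') :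
    x = x' := by
  have key : ∀ {g g' : E → ℕ} {w w' : E} {U U' : Set E} {j j' : ℕ},
      IsRedex E Set.univ g w z U j → IsRedex E Set.univ g' w' z U' j' → w ≤ w' → w = w' := by
    intro g g' w w' U U' j j' h h' hw
    rcases h.between hw h'.lt.le with rfl | rfl | hm
    · rfl
    · exact (lt_irrefl _ h'.lt).elim
    · exact ((h.of_mem hm).2.2.2.2.1 (h'.label_eq.trans h.label_eq.symm)).elim
  rcases E.comparable x x' (by rw [h.label_eq, h'.label_eq]; exact C.refl _) with hz | hz
  · exact key h h' hz
  · exact (key h' h hz).symm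

/-- The overlap `t s t s`: the labels of `z` and `z'` are concurrent, so `z` and `z'` are
comparable. If `z ≤ z'`, then `z` would be a second vertex of the middle `T' = {x}`; hence `z'` lies
between `x` and `z`. -/
theorem right_mem_of_left_mem (h : IsRedex E Set.univ f x z T i)
    (h' : IsRedex E Set.univ f' x' z' T' i') (hx : x ∈ T') : z' ∈ T := by
  obtain ⟨rfl, -, h1, h2, hl, hC⟩ := h'.of_mem hx
  have hC' : C.rel (E.label z') (E.label z) := by rw [← h.label_eq, ← h'.label_eq]; exact hC
  have hl' : E.label z ≠ E.label z' := by rw [← h.label_eq, ← h'.label_eq]; exact hl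
  rcases E.comparable z' z hC' with hz | hz
  · rcases h.between h2.le hz with rfl | rfl | hm
    · exact (lt_irrefl _ h2).elim
    · exact (hl' rfl).elim
    · exact hm
  · rcases h'.between (h1.trans h.lt).le hz with rfl | rfl | hm
    · exact (lt_asymm h1 h.lt).elim
    · exact (hl' rfl).elim
    · exact (h.ne (Set.mem_singleton_iff.1 hm).symm).elim

theorem left_mem_of_right_mem (h : IsRedex E Set.univ f x z T i)
    (h' : IsRedex E Set.univ f' x' z' T' i') (hz : z ∈ T') : x' ∈ T := by
  obtain ⟨rfl, -, h1, h2, hl, hC⟩ := h'.of_mem hz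
  have hC' : C.rel (E.label x') (E.label x) := by rw [h.label_eq]; exact hC
  have hl' : E.label x ≠ E.label x' := by rw [h.label_eq]; exact hl
  rcases E.comparable x' x hC' with hx | hx
  · rcases h'.between hx (h.lt.trans h2).le with rfl | rfl | hm
    · exact (hl' rfl).elim
    · exact (lt_asymm h2 h.lt).elim
    · exact (h.ne (Set.mem_singleton_iff.1 hm)).elim
  · rcases h.between hx h1.le with rfl | rfl | hm
    · exact (hl' rfl).elim
    · exact (lt_irrefl _ h1).elim
    · exact hm

/-- If neither deletion touches the other redex, that redex survives restriction, and the two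
deletions commute. -/
theorem diamond (h : IsRedex E Set.univ f x z T i) (h' : IsRedex E Set.univ f' x' z' T' i')
    {D D' : Set E} (hD : D = T ∪ {x} ∨ D = T ∪ {z}) (hD' : D' = T' ∪ {x'} ∨ D' = T' ∪ {z'})
    (h₁ : x ∉ D') (h₂ : z ∉ D') (h₃ : Disjoint T D') (h₁' : x' ∉ D) (h₂' : z' ∉ D)
    (h₃' : Disjoint T' D) : ∃ w, Red i' (sub E (Set.univ \ D)) w ∧
      Red i (sub E (Set.univ \ D')) w := by
  refine ⟨sub E ((Set.univ \ D) \ D'), ?_, ?_⟩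
  · exact (h'.restrict (S' := Set.univ \ D) (Set.subset_univ _) ⟨trivial, h₁'⟩ ⟨trivial, h₂'⟩
      fun v hv => ⟨trivial, Set.disjoint_left.1 h₃' hv⟩).red hD'
  · rw [Set.sdiff_sdiff_comm]
    exact (h.restrict (S' := Set.univ \ D') (Set.subset_univ _) ⟨trivial, h₁⟩ ⟨trivial, h₂⟩
      fun v hv => ⟨trivial, Set.disjoint_left.1 h₃ hv⟩).red hD

/-- Two redexes of which one ends where the other starts. -/
theorem diamond_of_eq (h : IsRedex E Set.univ f x z T i)
    (h' : IsRedex E Set.univ f' x' x T' i') : ∃ w, Red i' (sub E (Set.univ \ (T ∪ {z}))) w ∧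
      Red i (sub E (Set.univ \ (T' ∪ {x'}))) w := by
  have e1 := h.lt
  have e2 := h'.lt
  have hT : ∀ y ∈ T, x < y ∧ y < z := fun y hy => by
    obtain ⟨-, -, h1, h2, -⟩ := h.of_mem hy
    exact ⟨h1, h2⟩
  have hT' : ∀ y ∈ T', x' < y ∧ y < x := fun y hy => by
    obtain ⟨-, -, h1, h2, -⟩ := h'.of_mem hy
    exact ⟨h1, h2⟩
  refine h.diamond h' (Or.inr rfl) (Or.inl rfl) ?_ ?_ (Set.disjoint_left.2 ?_) ?_ ?_
    (Set.disjoint_left.2 ?_)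
  · rintro (hx | rfl)
    · exact lt_irrefl _ (hT' _ hx).2
    · exact lt_irrefl _ e2
  · rintro (hx | rfl)
    · exact lt_asymm (hT' _ hx).2 e1
    · exact lt_asymm e1 e2
  · rintro y hy (hx | rfl)
    · exact lt_asymm (hT' _ hx).2 (hT _ hy).1
    · exact lt_asymm e2 (hT _ hy).1
  · rintro (hx | rfl)
    · exact lt_asymm (hT _ hx).1 e2
    · exact lt_asymm e1 e2
  · rintro (hx | rfl)
    · exact lt_irrefl _ (hT _ hx).1
    · exact lt_irrefl _ e1
  · rintro y hy (hx | rfl)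
    · exact lt_asymm (hT' _ hy).2 (hT _ hx).1
    · exact lt_asymm (hT' _ hy).2 e1

end IsRedex

/-- Reduction is locally confluent. -/
theorem Red.locally_confluent {i i' : ℕ} {h y y' : Heap P C} (hr : Red i h y)
    (hr' : Red i' h y') : (i = i' ∧ y = y') ∨
      ∃ j j' w, Red j y w ∧ Red j' y' w ∧ i + j = i' + j' := by
  obtain ⟨E, rfl⟩ := exists_mk h
  rw [← sub_univ] at hr hr'
  obtain ⟨f, x, z, T, R, hy⟩ := hr.exists_isRedex
  obtain ⟨f', x', z', T', R', hy'⟩ := hr'.exists_isRedex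
  by_cases c₁ : x = x'
  · subst c₁
    obtain rfl := R.right_unique R'
    obtain rfl := R.T_eq R'
    exact Or.inl ⟨R.index_eq R', by rw [hy _ (Or.inl rfl), hy' _ (Or.inl rfl)]⟩
  by_cases c₂ : z = z'
  · subst c₂
    exact (c₁ (R.left_unique R')).elim
  -- When one redex starts where the other ends, the shared vertex is kept and the two outer ends
  -- are deleted.
  by_cases c₃ : x = z'
  · subst c₃
    obtain ⟨w, h1, h2⟩ := R.diamond_of_eq R'
    rw [← hy _ (Or.inr rfl)] at h1
    rw [← hy' _ (Or.inl rfl)] at h2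
    exact Or.inr ⟨_, _, w, h1, h2, add_comm _ _⟩
  by_cases c₄ : z = x'
  · subst c₄
    obtain ⟨w, h1, h2⟩ := R'.diamond_of_eq R
    rw [← hy _ (Or.inl rfl)] at h2
    rw [← hy' _ (Or.inr rfl)] at h1
    exact Or.inr ⟨_, _, w, h2, h1, add_comm _ _⟩
  -- Overlap `t s t s`: each middle is an end of the other redex, and a suitable choice of ends
  -- makes both reductions delete the same two vertices.
  by_cases c₅ : x ∈ T'
  · have hz := R.right_mem_of_left_mem R' c₅
    obtain ⟨rfl, rfl, -⟩ := R.of_mem hz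
    obtain ⟨rfl, rfl, -⟩ := R'.of_mem c₅
    refine Or.inl ⟨rfl, ?_⟩
    rw [hy _ (Or.inl rfl), hy' _ (Or.inr rfl), Set.union_comm]
  by_cases c₆ : x' ∈ T
  · have hz := R'.right_mem_of_left_mem R c₆
    obtain ⟨rfl, rfl, -⟩ := R'.of_mem hz
    obtain ⟨rfl, rfl, -⟩ := R.of_mem c₆
    refine Or.inl ⟨rfl, ?_⟩
    rw [hy _ (Or.inr rfl), hy' _ (Or.inl rfl), Set.union_comm]
  by_cases c₇ : z ∈ T'
  · have hz := R.left_mem_of_right_mem R' c₇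
    exact (c₆ hz).elim
  by_cases c₈ : z' ∈ T
  · exact (c₅ (R'.left_mem_of_right_mem R c₈)).elim
  by_cases c₉ : ∃ v, v ∈ T ∧ v ∈ T'
  · obtain ⟨v, hv, hv'⟩ := c₉
    obtain ⟨rfl, rfl, -⟩ := R.of_mem hv
    obtain ⟨rfl, rfl, -⟩ := R'.of_mem hv'
    -- Both redexes enclose the same vertex `v`. Either reduction removes it and turns the other
    -- redex into a square, so each path produces one factor δ.
    refine Or.inr ⟨1, 1, sub E ((Set.univ \ ({v} ∪ {z})) \ (∅ ∪ {z'})), ?_, ?_, rfl⟩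
    · rw [hy _ (Or.inr rfl)]
      refine (R'.restrict_empty (S' := Set.univ \ ({v} ∪ {z})) (Set.subset_univ _) ⟨trivial, ?_⟩ ⟨trivial, ?_⟩ ?_).red
        (Or.inr rfl)
      · rintro (h | h)
        · exact c₆ h
        · exact c₄ h.symm
      · rintro (h | h)
        · exact c₈ h
        · exact c₂ h.symm
      · rw [Set.disjoint_left]
        exact fun u hu hu' => hu'.2 (Or.inl hu)
    · have : (Set.univ \ ({v} ∪ {z})) \ (∅ ∪ {z'}) = (Set.univ \ ({v} ∪ {z'})) \ (∅ ∪ {z}) := by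
        ext u
        simp only [Set.mem_sdiff, Set.mem_union, Set.mem_univ, Set.mem_empty_iff_false]
        tauto
      rw [hy' _ (Or.inr rfl), this]
      refine (R.restrict_empty (S' := Set.univ \ ({v} ∪ {z'})) (Set.subset_univ _) ⟨trivial, ?_⟩ ⟨trivial, ?_⟩ ?_).red
        (Or.inr rfl)
      · rintro (h | h)
        · exact c₅ h
        · exact c₃ h
      · rintro (h | h)
        · exact c₇ h
        · exact c₂ h
      · rw [Set.disjoint_left]
        exact fun u hu hu' => hu'.2 (Or.inl hu)
  · obtain ⟨w, h1, h2⟩ := R.diamond R' (Or.inr rfl) (Or.inr rfl) (by rintro (h | h); exacts [c₅ h, c₃ h])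
      (by rintro (h | h); exacts [c₇ h, c₂ h])
      (Set.disjoint_left.2 (by
        rintro u hu (h | rfl)
        exacts [c₉ ⟨u, hu, h⟩, c₈ hu]))
      (by rintro (h | h); exacts [c₆ h, c₄ h.symm])
      (by rintro (h | h); exacts [c₈ h, c₂ h.symm])
      (Set.disjoint_left.2 (by
        rintro u hu (h | rfl)
        exacts [c₉ ⟨u, h, hu⟩, c₇ hu]))
    rw [← hy _ (Or.inr rfl)] at h1
    rw [← hy' _ (Or.inr rfl)] at h2
    exact Or.inr ⟨_, _, w, h1, h2, add_comm _ _⟩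

/-! ### Normal forms -/

/-- The number of vertices of a heap. -/
def card : Heap P C → ℕ :=
  Quotient.lift (fun E : LabelledHeap P C => Fintype.card E)
    (fun _ _ ⟨φ⟩ => Fintype.card_congr φ.1.toEquiv)

theorem card_mul (a b : Heap P C) : card (a * b) = card a + card b := by
  obtain ⟨E, rfl⟩ := exists_mk a
  obtain ⟨F, rfl⟩ := exists_mk b
  exact Fintype.card_sum

theorem card_single (p : P) : card (single C p) = 1 := rfl

theorem Red.card_lt {i : ℕ} {x y : Heap P C} (h : Red i x y) : card y < card x := by
  obtain ⟨a, s, m, b, i, hm⟩ := h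
  simp only [card_mul, card_single]
  omega

/-- The heap admits no reduction. -/
def Irred (x : Heap P C) : Prop := ∀ i y, ¬ Red i x y

/-- The heap `x` reduces to `δ ^ m g` with `g` irreducible. -/
inductive NF : Heap P C → ℕ → Heap P C → Prop
  | refl (x : Heap P C) : Irred x → NF x 0 x
  | step {i m : ℕ} {x y g : Heap P C} : Red i x y → NF y m g → NF x (i + m) g

theorem NF.irred {x g : Heap P C} {m : ℕ} (h : NF x m g) : Irred g := by
  induction h with
  | refl x hx => exact hx
  | step _ _ ih => exact ih

theorem NF.exists (x : Heap P C) : ∃ m g, NF x m g := by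
  induction hn : card x using Nat.strong_induction_on generalizing x with
  | _ n ih =>
    by_cases hx : Irred x
    · exact ⟨0, x, .refl x hx⟩
    · simp only [Irred, not_forall, not_not] at hx
      obtain ⟨i, y, hy⟩ := hx
      obtain ⟨m, g, hg⟩ := ih _ (hn ▸ hy.card_lt) y rfl
      exact ⟨_, g, .step hy hg⟩

/-- Newman's lemma by induction on the number of vertices. Local confluence also equates the
exponents along the two sides, so `m` is determined together with `g`. -/
theorem NF.unique {x g g' : Heap P C} {m m' : ℕ} (h : NF x m g) (h' : NF x m' g') :
    m = m' ∧ g = g' := by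
  induction hn : card x using Nat.strong_induction_on generalizing x m m' g g' with
  | _ n ih =>
    subst hn
    cases h with
    | refl _ hx =>
      cases h' with
      | refl _ _ => exact ⟨rfl, rfl⟩
      | step hr _ => exact (hx _ _ hr).elim
    | step hr h =>
      cases h' with
      | refl _ hx => exact (hx _ _ hr).elim
      | step hr' h' =>
        rcases hr.locally_confluent hr' with ⟨rfl, rfl⟩ | ⟨j, j', w, h1, h2, hj⟩
        · obtain ⟨rfl, rfl⟩ := ih _ hr.card_lt h h' rfl
          exact ⟨rfl, rfl⟩
        · obtain ⟨k, g₀, hw⟩ := NF.exists w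
          obtain ⟨e1, rfl⟩ := ih _ hr.card_lt h (.step h1 hw) rfl
          obtain ⟨e2, rfl⟩ := ih _ hr'.card_lt h' (.step h2 hw) rfl
          exact ⟨by omega, rfl⟩

/-- Normalising a factor first does not change the normal form of a product. This makes `act`
multiplicative. -/
theorem NF.mul_left {x g g' c : Heap P C} {m m' : ℕ} (h : NF x m g) (h' : NF (c * g) m' g') :
    NF (c * x) (m + m') g' := by
  induction h with
  | refl x _ => rwa [zero_add]
  | step hr _ ih =>
    rw [add_assoc]
    exact .step (hr.mul_left c) (ih h')

/-! ### Property P2 -/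

theorem exists_concurrent_step {E : LabelledHeap P C} {a b : E} (h : a < b) :
    ∃ c, a < c ∧ c ≤ b ∧ C.rel (E.label a) (E.label c) := by
  have h' := (E.le_iff a b).1 h.le
  have hne := h.ne
  clear h
  induction h' using Relation.TransGen.head_induction_on with
  | single h => exact ⟨b, lt_of_le_of_ne h.1 hne, le_rfl, h.2⟩
  | @head a c h hcb ih =>
    by_cases hac : a = c
    · subst hac
      exact ih hne
    · exact ⟨c, lt_of_le_of_ne h.1 hac, (E.le_iff c b).2 hcb, h.2⟩

/-- An open interval with the right content can always be isolated as a factor of the heap, because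
order intervals are convex. -/
theorem not_irred_of_chain {E : LabelledHeap P C} {x z : E} {T : Set E} {i : ℕ}
    (hlt : x < z) (hl : E.label x = E.label z) (hm : IsMiddle (E.label x) (sub E T) i)
    (hT : ∀ v, v ∈ T ↔ x < v ∧ v < z) : ¬ Irred (mk E) := by
  classical
  have hxT : x ∉ T := fun h => lt_irrefl _ ((hT x).1 h).1
  have hzT : z ∉ T := fun h => lt_irrefl _ ((hT z).1 h).2
  have hzx : z ≠ x := hlt.ne'
  have hxz : x ≠ z := hlt.ne
  -- Outside the interval, vertices below `z` go to the left factor, the others to the right. A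
  -- vertex under one of level 0 is again below `z` and not above `x`.
  let f : E → ℕ := fun v =>
    if v = x then 1 else if v = z then 3 else if v ∈ T then 2 else if v < z then 0 else 4
  have R : IsRedex E Set.univ f x z T i :=
    { level := by
        intro u _ v _ _ huv
        by_cases hvx : v = x
        · subst hvx
          rcases huv.eq_or_lt with rfl | huv
          · exact le_rfl
          · have h1 : u ∉ T := fun h => lt_asymm ((hT u).1 h).1 huv
            simp [f, huv.ne, (huv.trans hlt).ne, h1, huv.trans hlt]
        by_cases hvz : v = z
        · subst hvz
          rcases huv.eq_or_lt with rfl | huv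
          · exact le_rfl
          · by_cases h1 : u = x
            · simp [f, h1, hzx]
            · by_cases h2 : u ∈ T <;> simp [f, h1, h2, hzx, huv.ne, huv]
        by_cases hvT : v ∈ T
        · have h2 : u < z := huv.trans_lt ((hT v).1 hvT).2
          by_cases h1 : u = x
          · simp [f, h1, hvx, hvz, hvT]
          · by_cases h3 : u ∈ T <;> simp [f, h1, h2, h2.ne, h3, hvx, hvz, hvT]
        by_cases hlt' : v < z
        · have h1 : u ≠ x := by
            rintro rfl
            exact hvT ((hT v).2 ⟨lt_of_le_of_ne huv (Ne.symm hvx), hlt'⟩)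
          have h2 : u < z := huv.trans_lt hlt'
          have h3 : u ∉ T := fun h =>
            hvT ((hT v).2 ⟨((hT u).1 h).1.trans_le huv, hlt'⟩)
          simp [f, h1, h2, h2.ne, h3]
        · have : f v = 4 := by simp [f, hvx, hvz, hvT, hlt']
          rw [this]
          simp only [f]
          split_ifs <;> omega
      x_mem := trivial
      z_mem := trivial
      fx := fun v _ => by
        simp only [f]
        split_ifs <;> simp_all
      fz := fun v _ => by
        simp only [f]
        split_ifs <;> simp_all
      fT := fun v => by
        simp only [f]
        split_ifs <;> simp_all
      label_eq := hl
      middle := hm }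
  intro h
  have := R.red (Or.inl rfl)
  rw [sub_univ] at this
  exact h _ _ this

theorem hasP2_iff_irred (x : Heap P C) : x.HasP2 ↔ Irred x := by
  obtain ⟨E, rfl⟩ := exists_mk x
  change E.HasP2 ↔ _
  constructor
  · intro h i y hr
    rw [← sub_univ] at hr
    obtain ⟨f, x, z, T, R, -⟩ := hr.exists_isRedex
    rcases R.middle_cases with ⟨rfl, -⟩ | ⟨y, rfl, -⟩
    · refine h.1 x z R.label_eq ⟨by simpa using R.lt, ?_⟩
      intro a ha b hb y hay hyb
      have h1 : x ≤ a := by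
        rcases List.mem_pair.1 ha with rfl | rfl
        exacts [le_rfl, R.lt.le]
      have h2 : b ≤ z := by
        rcases List.mem_pair.1 hb with rfl | rfl
        exacts [R.lt.le, le_rfl]
      simpa using R.between (h1.trans hay.le) (hyb.le.trans h2)
    · obtain ⟨-, -, e1, e2, -⟩ := R.of_mem (Set.mem_singleton y)
      refine h.2 x y z R.label_eq ⟨by simp [e1, e2, R.lt], ?_⟩
      intro a ha b hb w hay hyb
      have h1 : x ≤ a := by
        simp only [List.mem_cons, List.not_mem_nil, or_false] at ha
        rcases ha with rfl | rfl | rfl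
        exacts [le_rfl, e1.le, R.lt.le]
      have h2 : b ≤ z := by
        simp only [List.mem_cons, List.not_mem_nil, or_false] at hb
        rcases hb with rfl | rfl | rfl
        exacts [R.lt.le, e2.le, le_rfl]
      have := R.between (h1.trans hay.le) (hyb.le.trans h2)
      simp only [Set.mem_singleton_iff] at this
      simp only [List.mem_cons, List.not_mem_nil, or_false]
      tauto
  · intro h
    have h2 : ∀ x z : E, E.label x = E.label z → ¬ E.IsConvexChain [x, z] := by
      intro x z hl hc
      have hlt : x < z := by simpa using hc.1
      refine not_irred_of_chain (T := ∅) (i := 1) hlt hl (Or.inl ⟨sub_empty E, rfl⟩) ?_ h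
      intro v
      simp only [Set.mem_empty_iff_false, false_iff, not_and]
      intro h1 h3
      have := hc.2 x (by simp) z (by simp) v h1 h3
      rcases List.mem_pair.1 this with rfl | rfl
      exacts [lt_irrefl _ h1, lt_irrefl _ h3]
    refine ⟨h2, ?_⟩
    intro x y z hl hc
    have hlt : x < y ∧ x < z ∧ y < z := by simpa [and_assoc] using hc.1
    obtain ⟨hxy, hxz, hyz⟩ := hlt
    have hb : ∀ v, x < v → v < z → v = y := by
      intro v h1 h3
      have := hc.2 x (by simp) z (by simp) v h1 h3
      simp only [List.mem_cons, List.not_mem_nil, or_false] at this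
      rcases this with rfl | rfl | rfl
      exacts [(lt_irrefl _ h1).elim, rfl, (lt_irrefl _ h3).elim]
    -- The rule `s t s` needs `t ≠ s`; with three equal labels the pair `x < y` is already a convex
    -- chain.
    by_cases hxl : E.label y = E.label x
    · refine h2 x y hxl.symm ⟨by simpa using hxy, ?_⟩
      intro a ha b hb' v h1 h3
      have e1 : x ≤ a := by
        rcases List.mem_pair.1 ha with rfl | rfl
        exacts [le_rfl, hxy.le]
      have e2 : b ≤ y := by
        rcases List.mem_pair.1 hb' with rfl | rfl
        exacts [hxy.le, le_rfl]
      exact List.mem_pair.2 (Or.inr (hb v (e1.trans_lt h1) ((h3.trans_le e2).trans hyz)))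
    · have hC : C.rel (E.label x) (E.label y) := by
        -- Convexity alone does not say that `x` and `y` have concurrent labels. The first step of a
        -- concurrent chain from `x` to `y` lies in the interval, hence ends at `y`.
        obtain ⟨c, h1, h3, h4⟩ := exists_concurrent_step hxy
        rw [← hb c h1 (h3.trans_lt hyz)]
        exact h4
      refine not_irred_of_chain (T := {y}) (i := 0) hxz hl
        (Or.inr ⟨_, hxl, hC, sub_singleton E y, rfl⟩) ?_ h
      intro v
      rw [Set.mem_singleton_iff]
      exact ⟨by rintro rfl; exact ⟨hxy, hyz⟩, fun h => hb v h.1 h.2⟩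

end Heap

/-! ### The kernel of ∂ in terms of jumps -/

namespace LabelledHeap

variable (k : Type*) [Field k]

open Classical in
/-- The sum of the values on the vertices labelled `p`. -/
noncomputable def labelSum (E : LabelledHeap P C) (p : P) : (E → k) →ₗ[k] k :=
  ∑ v : E with E.label v = p, LinearMap.proj v

open Classical in
/-- The sum of the values on the vertices below `w` with a label concurrent to, but different
from, that of `w`. -/
noncomputable def lowerSum (E : LabelledHeap P C) (w : E) : (E → k) →ₗ[k] k :=
  ∑ v : E with v ≤ w ∧ C.rel (E.label v) (E.label w) ∧ E.label v ≠ E.label w, LinearMap.proj v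

open Classical in
/-- The sum of the values on the vertices below `x` with the same label. -/
noncomputable def prefixSum (E : LabelledHeap P C) (x : E) : (E → k) →ₗ[k] k :=
  ∑ v : E with v ≤ x ∧ E.label v = E.label x, LinearMap.proj v

/-- A model of the kernel of the boundary map of the subheap on `S`: a combination of edges is
encoded by its jumps at the vertices. -/
noncomputable def cycleSpace (E : LabelledHeap P C) (S : Set E) : Submodule k (E → k) where
  carrier := {g | (∀ v, v ∉ S → g v = 0) ∧ (∀ p, E.labelSum k p g = 0) ∧
    ∀ w ∈ S, E.lowerSum k w g = 0}
  add_mem' := by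
    rintro g h ⟨g1, g2, g3⟩ ⟨h1, h2, h3⟩
    exact ⟨fun v hv => by simp [g1 v hv, h1 v hv], fun p => by simp [g2, h2],
      fun w hw => by simp [g3 w hw, h3 w hw]⟩
  zero_mem' := ⟨fun _ _ => rfl, fun _ => map_zero _, fun _ _ => map_zero _⟩
  smul_mem' := by
    rintro c g ⟨g1, g2, g3⟩
    exact ⟨fun v hv => by simp [g1 v hv], fun p => by simp [g2], fun w hw => by simp [g3 w hw]⟩

variable {k} {E : LabelledHeap P C}

theorem mem_cycleSpace {S : Set E} {g : E → k} : g ∈ E.cycleSpace k S ↔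
    (∀ v, v ∉ S → g v = 0) ∧ (∀ p, E.labelSum k p g = 0) ∧
      ∀ w ∈ S, E.lowerSum k w g = 0 := Iff.rfl

open Classical in
theorem labelSum_apply (p : P) (g : E → k) :
    E.labelSum k p g = ∑ v : E with E.label v = p, g v := by
  simp [labelSum]

open Classical in
theorem lowerSum_apply (w : E) (g : E → k) : E.lowerSum k w g =
    ∑ v : E with v ≤ w ∧ C.rel (E.label v) (E.label w) ∧ E.label v ≠ E.label w, g v := by
  simp [lowerSum]

open Classical in
theorem prefixSum_apply (x : E) (g : E → k) : E.prefixSum k x g =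
    ∑ v : E with v ≤ x ∧ E.label v = E.label x, g v := by
  simp [prefixSum]

open Classical in
theorem sum_filter_single (q : E → Prop) [DecidablePred q] (x : E) :
    ∑ v : E with q v, (Pi.single x (1 : k) : E → k) v = if q x then 1 else 0 := by
  simp [Pi.single_apply]

open Classical in
theorem labelSum_single (p : P) (x : E) :
    E.labelSum k p (Pi.single x 1) = if E.label x = p then 1 else 0 := by
  rw [labelSum_apply, sum_filter_single]

open Classical in
theorem lowerSum_single (w x : E) : E.lowerSum k w (Pi.single x 1) =
    if x ≤ w ∧ C.rel (E.label x) (E.label w) ∧ E.label x ≠ E.label w then 1 else 0 := by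
  rw [lowerSum_apply, sum_filter_single]

open Classical in
theorem prefixSum_single (w x : E) : E.prefixSum k w (Pi.single x 1) =
    if x ≤ w ∧ E.label x = E.label w then 1 else 0 := by
  rw [prefixSum_apply, sum_filter_single]

open Classical in
/-- The jumps of a combination of edges. -/
noncomputable def jump (k : Type*) [Field k] (E : LabelledHeap P C) :
    (E.Edge →₀ k) →ₗ[k] (E → k) :=
  Finsupp.linearCombination k fun e : E.Edge => Pi.single e.1.1 1 - Pi.single e.1.2 1

theorem labelSum_jump (p : P) (f : E.Edge →₀ k) : E.labelSum k p (E.jump k f) = 0 := by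
  induction f using Finsupp.induction_linear with
  | zero => simp
  | add f g hf hg => simp [hf, hg]
  | single e c =>
    rw [jump, Finsupp.linearCombination_single, map_smul, map_sub, labelSum_single,
      labelSum_single, e.2.2.1, sub_self, smul_zero]

open Classical in
theorem edgeBoundary_apply (x y w : E) : E.edgeBoundary k x y w =
    if x < w ∧ w < y ∧ C.rel (E.label w) (E.label x) then 1 else 0 := by
  rw [edgeBoundary, Finsupp.finsetSum_apply]
  simp [Finsupp.single_apply]

/-- For an edge `(x, y)` concurrent to `w`, the jumps +1 at `x` and -1 at `y` leave 1 below `w`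
exactly when `x < w < y`. If `w` has the label of the edge, both sides vanish, since no such `w`
lies inside an edge. -/
theorem lowerSum_jump (w : E) (f : E.Edge →₀ k) :
    E.lowerSum k w (E.jump k f) = E.boundary k f w := by
  classical
  induction f using Finsupp.induction_linear with
  | zero => simp
  | add f g hf hg => simp [hf, hg]
  | single e c =>
    rw [jump, boundary, Finsupp.linearCombination_single, Finsupp.linearCombination_single,
      map_smul, map_sub, lowerSum_single, lowerSum_single, Finsupp.smul_apply,
      edgeBoundary_apply]
    congr 1
    obtain ⟨⟨x, y⟩, hlt, hl, hb⟩ := e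
    dsimp only at hlt hl hb ⊢
    simp only [← hl]
    by_cases hC : C.rel (E.label x) (E.label w)
    · have hC' := C.symm _ _ hC
      by_cases hne : E.label x = E.label w
      · rw [if_neg (by tauto), if_neg (by tauto), if_neg, sub_zero]
        exact fun h => hb ⟨w, hne.symm, h.1, h.2.1⟩
      · have h1 : x ≤ w ↔ x < w := ⟨fun h => lt_of_le_of_ne h (by rintro rfl; exact hne rfl),
          le_of_lt⟩
        have h2 : y ≤ w ↔ ¬ w < y := by
          constructor
          · exact fun h => not_lt_of_ge h
          · intro h
            rcases E.comparable y w (by rw [← hl]; exact hC) with h' | h'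
            · exact h'
            · rcases h'.eq_or_lt with rfl | h'
              · exact le_rfl
              · exact (h h').elim
        rw [h1, h2]
        by_cases hw : w < y
        · simp [hw, hC, hC', hne]
        · have : x < w := by
            rw [← not_iff_not] at h2
            exact hlt.trans_le (not_not.1 (mt h2.1 (not_not.2 hw)))
          simp [hw, hC, hC', hne, this]
    · have hC' : ¬ C.rel (E.label w) (E.label x) := fun h => hC (C.symm _ _ h)
      simp [hC, hC']

theorem comparable_of_label_eq {a b : E} (h : E.label a = E.label b) : a ≤ b ∨ b ≤ a :=
  E.comparable a b (by rw [h]; exact C.refl _)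

theorem edge_eq_of_fst_eq {e e' : E.Edge} (h : e.1.1 = e'.1.1) : e = e' := by
  obtain ⟨⟨x, y⟩, hlt, hl, hb⟩ := e
  obtain ⟨⟨x', y'⟩, hlt', hl', hb'⟩ := e'
  dsimp only at *
  subst h
  have : y = y' := by
    by_contra hne
    rcases comparable_of_label_eq (hl.symm.trans hl') with h | h
    · exact hb' ⟨y, hl.symm, hlt, lt_of_le_of_ne h hne⟩
    · exact hb ⟨y', hl'.symm, hlt', lt_of_le_of_ne h (Ne.symm hne)⟩
  subst this
  rfl

/-- Vertices with a common label form a chain, so summing jumps up to the start of `e` telescopes.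
This is the inverse of `jump`. -/
theorem prefixSum_jump (e : E.Edge) (f : E.Edge →₀ k) :
    E.prefixSum k e.1.1 (E.jump k f) = f e := by
  classical
  induction f using Finsupp.induction_linear with
  | zero => simp
  | add f g hf hg => simp [hf, hg]
  | single e' c =>
    rw [jump, Finsupp.linearCombination_single, map_smul, map_sub, prefixSum_single,
      prefixSum_single, Finsupp.single_apply, smul_eq_mul]
    have hlt' := e'.2.1
    have hl' := e'.2.2.1
    by_cases he : e' = e
    · subst he
      rw [if_pos ⟨le_rfl, rfl⟩, if_neg (fun h => not_le_of_gt hlt' h.1), if_pos rfl]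
      simp
    · rw [if_neg he]
      by_cases hl : E.label e'.1.1 = E.label e.1.1
      · have hiff : e'.1.1 ≤ e.1.1 ↔ e'.1.2 ≤ e.1.1 := by
          refine ⟨fun h => ?_, fun h => hlt'.le.trans h⟩
          by_contra h2
          have h3 : e.1.1 < e'.1.2 := by
            rcases comparable_of_label_eq (hl'.symm.trans hl) with h' | h'
            · exact (h2 h').elim
            · exact lt_of_le_not_ge h' h2
          rcases h.eq_or_lt with h | h
          · exact he (edge_eq_of_fst_eq h)
          · exact e'.2.2.2 ⟨e.1.1, hl.symm, h, h3⟩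
        rw [← hl', hiff, sub_self, mul_zero]
      · rw [if_neg (fun h => hl h.2), if_neg (fun h => hl (hl'.trans h.2)), sub_self, mul_zero]

theorem eq_zero_of_prefixSum {g : E → k} (h : ∀ x, E.prefixSum k x g = 0) : g = 0 := by
  classical
  have key : ∀ x, g x = 0 := by
    intro x
    induction x using (wellFounded_lt (α := E)).induction with
    | _ x ih =>
      have hx := h x
      rw [prefixSum_apply, Finset.sum_eq_single x] at hx
      · exact hx
      · intro v hv hne
        exact ih v (lt_of_le_of_ne (Finset.mem_filter.1 hv).2.1 hne)
      · intro hx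
        simp at hx
  exact funext key

theorem exists_edge {x z : E} (hlt : x < z) (hl : E.label x = E.label z) :
    ∃ e : E.Edge, e.1.1 = x := by
  obtain ⟨y, hy⟩ := Set.Finite.exists_minimal (s := {y : E | x < y ∧ E.label x = E.label y})
    (Set.toFinite _) ⟨z, hlt, hl⟩
  refine ⟨⟨⟨x, y⟩, hy.1.1, hy.1.2, ?_⟩, rfl⟩
  rintro ⟨v, hv, h1, h2⟩
  exact not_le_of_gt h2 (hy.2 ⟨h1, hv.symm⟩ h2.le)

/-- A vertex starting no edge is the highest of its label, and there the prefix sum is the full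
label sum. -/
theorem eq_zero_of_prefixSum_edge {g : E → k} (hg : ∀ p, E.labelSum k p g = 0)
    (h : ∀ e : E.Edge, E.prefixSum k e.1.1 g = 0) : g = 0 := by
  classical
  refine eq_zero_of_prefixSum fun x => ?_
  by_cases hx : ∃ z, x < z ∧ E.label x = E.label z
  · obtain ⟨z, h1, h2⟩ := hx
    obtain ⟨e, rfl⟩ := exists_edge h1 h2
    exact h e
  · rw [prefixSum_apply, ← hg (E.label x), labelSum_apply]
    congr 1
    ext v
    simp only [Finset.mem_filter, Finset.mem_univ, true_and, and_iff_right_iff_imp]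
    intro hv
    rcases comparable_of_label_eq hv with h' | h'
    · exact h'
    · rcases h'.eq_or_lt with rfl | h'
      · exact le_rfl
      · exact (hx ⟨v, h', hv.symm⟩).elim

theorem finite_edge (E : LabelledHeap P C) : Finite E.Edge :=
  Subtype.finite

variable (k) in
theorem dimKer_eq_finrank (E : LabelledHeap P C) :
    E.dimKer k = Module.finrank k (E.cycleSpace k Set.univ) := by
  classical
  have := finite_edge E
  have := Fintype.ofFinite E.Edge
  have hmem : ∀ f, f ∈ LinearMap.ker (E.boundary k) ↔ E.jump k f ∈ E.cycleSpace k Set.univ := by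
    intro f
    rw [LinearMap.mem_ker, mem_cycleSpace]
    constructor
    · intro h
      exact ⟨fun v hv => (hv trivial).elim, fun p => labelSum_jump p f,
        fun w _ => by rw [lowerSum_jump, h]; rfl⟩
    · rintro ⟨-, -, h⟩
      ext w
      rw [← lowerSum_jump, h w trivial]
      rfl
  refine LinearEquiv.finrank_eq (LinearEquiv.ofBijective
    ((E.jump k).restrict fun f hf => (hmem f).1 hf) ⟨?_, ?_⟩)
  · intro f f' h
    have h' : E.jump k f.1 = E.jump k f'.1 := congrArg Subtype.val h
    refine Subtype.ext (Finsupp.ext fun e => ?_)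
    rw [← prefixSum_jump, ← prefixSum_jump, h']
  · rintro ⟨g, hg⟩
    let f : E.Edge →₀ k := Finsupp.equivFunOnFinite.symm fun e => E.prefixSum k e.1.1 g
    have hf : E.jump k f = g := by
      rw [← sub_eq_zero]
      refine eq_zero_of_prefixSum_edge (fun p => ?_) fun e => ?_
      · rw [map_sub, labelSum_jump, hg.2.1, sub_zero]
      · rw [map_sub, prefixSum_jump, sub_eq_zero]
        rfl
    exact ⟨⟨f, (hmem f).2 (hf ▸ hg)⟩, Subtype.ext hf⟩

theorem sum_subheap {S : Set E} {g : E → k} (hg : ∀ v, v ∉ S → g v = 0)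
    (s : Finset E) (s' : Finset (E.subheap S)) (hs : ∀ v, v ∈ s' ↔ v.1 ∈ s) :
    ∑ v ∈ s', g v.1 = ∑ v ∈ s, g v :=
  Finset.sum_of_injOn (fun v : E.subheap S => v.1) (fun _ _ _ _ h => Subtype.ext h)
    (fun v hv => (hs v).1 hv)
    (fun v hv hv' => hg v fun hvS => hv' ⟨⟨v, hvS⟩, (hs ⟨v, hvS⟩).2 hv, rfl⟩) fun _ _ => rfl

/-- The equations involve only concurrent pairs, on which the weaker order of the subheap agrees
with that of `E`. In contrast, deleting vertices changes the edges, which is why jumps are used. -/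
theorem restrict_mem_cycleSpace {S : Set E} {g : E → k} (hg : ∀ v, v ∉ S → g v = 0) :
    (fun v : E.subheap S => g v.1) ∈ (E.subheap S).cycleSpace k Set.univ ↔
      g ∈ E.cycleSpace k S := by
  classical
  have h1 : ∀ p, (E.subheap S).labelSum k p (fun v => g v.1) = E.labelSum k p g := by
    intro p
    rw [labelSum_apply, labelSum_apply]
    refine sum_subheap hg _ _ fun v => ?_
    rw [Finset.mem_filter, Finset.mem_filter]
    exact and_congr (by simp) Iff.rfl
  have h2 : ∀ w : E.subheap S,
      (E.subheap S).lowerSum k w (fun v => g v.1) = E.lowerSum k w.1 g := by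
    intro w
    rw [lowerSum_apply, lowerSum_apply]
    refine sum_subheap hg _ _ fun v => ?_
    rw [Finset.mem_filter, Finset.mem_filter]
    exact and_congr (by simp) ⟨fun h => ⟨E.le_of_subheap_le h.1, h.2⟩,
      fun h => ⟨E.subheap_le_of_le h.2.1 h.1, h.2⟩⟩
  rw [mem_cycleSpace, mem_cycleSpace]
  simp only [h1, h2]
  exact ⟨fun h => ⟨hg, h.2.1, fun w hw => h.2.2 ⟨w, hw⟩ trivial⟩,
    fun h => ⟨fun v hv => (hv trivial).elim, h.2.1, fun w _ => h.2.2 w.1 w.2⟩⟩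

variable (k) in
theorem dimKer_subheap (E : LabelledHeap P C) (S : Set E) :
    (E.subheap S).dimKer k = Module.finrank k (E.cycleSpace k S) := by
  classical
  rw [dimKer_eq_finrank]
  let r : (E → k) →ₗ[k] (E.subheap S → k) :=
    LinearMap.funLeft k k (fun v : E.subheap S => v.1)
  refine (LinearEquiv.finrank_eq (LinearEquiv.ofBijective
    (r.restrict (p := E.cycleSpace k S) (q := (E.subheap S).cycleSpace k Set.univ)
      fun g hg => (restrict_mem_cycleSpace hg.1).2 hg) ⟨?_, ?_⟩)).symm
  · rintro ⟨g, hg⟩ ⟨g', hg'⟩ h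
    refine Subtype.ext (funext fun v => ?_)
    by_cases hv : v ∈ S
    · exact congrFun (congrArg Subtype.val h) (⟨v, hv⟩ : S)
    · exact (hg.1 v hv).trans (hg'.1 v hv).symm
  · rintro ⟨g, hg⟩
    let g' : E → k := fun v => if h : v ∈ S then g ⟨v, h⟩ else 0
    have h0 : ∀ v, v ∉ S → g' v = 0 := fun v hv => dif_neg hv
    have hr : (fun v : E.subheap S => g' v.1) = g := funext fun v => dif_pos v.2
    exact ⟨⟨g', (restrict_mem_cycleSpace h0).1 (hr ▸ hg)⟩, Subtype.ext hr⟩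

/-! ### Dismantlable heaps -/

open Classical in
theorem sum_label_filter_eq_zero {g : E → k} (hg : ∀ p, E.labelSum k p g = 0) (q : P → Prop) :
    ∑ v : E with q (E.label v), g v = 0 := by
  rw [← Finset.sum_fiberwise_of_maps_to (t := (Finset.univ.image E.label).filter q)
    (g := E.label)]
  · refine Finset.sum_eq_zero fun p hp => ?_
    rw [← hg p, labelSum_apply, Finset.filter_filter]
    congr 1
    ext v
    simp only [Finset.mem_filter, Finset.mem_univ, true_and, and_iff_right_iff_imp]
    rintro rfl
    exact (Finset.mem_filter.1 hp).2
  · intro v hv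
    simpa using hv

/-- The only vertex above `b` concurrent to it is `a`. The sum of `g` over all labels concurrent to
and different from that of `b` is zero, and it equals `lowerSum b` plus the value at `a`. -/
theorem apply_eq_zero_of_precPlus {a : E} (h : E.PrecPlus a) {g : E → k}
    (hg : g ∈ E.cycleSpace k Set.univ) : g a = 0 := by
  classical
  obtain ⟨ha, b, hb, hl, hb'⟩ := h
  have habove : ∀ v, C.rel (E.label b.1) (E.label v) → b.1 < v → v = a := by
    intro v hC hv
    by_contra hva
    have h1 : @LE.le (E.delete a) _ b ⟨v, hva⟩ := E.subheap_le_of_le hC hv.le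
    exact not_le_of_gt hv (E.le_of_subheap_le (hb h1))
  have hba : b.1 < a ∧ C.rel (E.label b.1) (E.label a) := by
    rw [not_isMax_iff] at hb'
    obtain ⟨c, hc⟩ := hb'
    obtain ⟨v, hv, -, hC⟩ := Heap.exists_concurrent_step hc
    obtain rfl := habove v hC hv
    exact ⟨hv, hC⟩
  have hlow := hg.2.2 b.1 trivial
  rw [lowerSum_apply] at hlow
  have htot : ∑ v ∈ insert a (Finset.univ.filter fun v : E => v ≤ b.1 ∧
      C.rel (E.label v) (E.label b.1) ∧ E.label v ≠ E.label b.1), g v = 0 := by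
    rw [← sum_label_filter_eq_zero hg.2.1
      (fun p => C.rel p (E.label b.1) ∧ p ≠ E.label b.1)]
    refine Finset.sum_congr ?_ fun _ _ => rfl
    ext v
    simp only [Finset.mem_filter, Finset.mem_univ, true_and, Finset.mem_insert]
    constructor
    · rintro (rfl | h)
      · exact ⟨C.symm _ _ hba.2, hl.symm⟩
      · exact h.2
    · rintro ⟨hC, hne⟩
      rcases E.comparable v b.1 hC with h | h
      · exact Or.inr ⟨h, hC, hne⟩
      · exact Or.inl (habove v (C.symm _ _ hC)
          (lt_of_le_of_ne h (by rintro rfl; exact hne rfl)))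
  rw [Finset.sum_insert, hlow, add_zero] at htot
  · exact htot
  · intro h
    exact not_le_of_gt hba.1 (Finset.mem_filter.1 h).2.1

theorem exists_concurrent_step_below {a b : E} (h : a < b) :
    ∃ c, a ≤ c ∧ c < b ∧ C.rel (E.label c) (E.label b) := by
  have h' := (E.le_iff a b).1 h.le
  have hne := h.ne
  clear h
  induction h' with
  | single h => exact ⟨a, le_rfl, lt_of_le_of_ne h.1 hne, h.2⟩
  | @tail c b hac h ih =>
    by_cases hcb : c = b
    · subst hcb
      exact ih hne
    · exact ⟨c, (E.le_iff a c).2 hac, lt_of_le_of_ne h.1 hcb, h.2⟩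

/-- Here `a` is the only concurrent vertex below `b`, so `lowerSum b` is just the value at `a`. -/
theorem apply_eq_zero_of_precMinus {a : E} (h : E.PrecMinus a) {g : E → k}
    (hg : g ∈ E.cycleSpace k Set.univ) : g a = 0 := by
  classical
  obtain ⟨ha, b, hb, hl, hb'⟩ := h
  have hbelow : ∀ v, C.rel (E.label v) (E.label b.1) → v < b.1 → v = a := by
    intro v hC hv
    by_contra hva
    have h1 : @LE.le (E.delete a) _ ⟨v, hva⟩ b := E.subheap_le_of_le hC hv.le
    exact not_le_of_gt hv (E.le_of_subheap_le (hb h1))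
  have hba : a < b.1 ∧ C.rel (E.label a) (E.label b.1) := by
    rw [not_isMin_iff] at hb'
    obtain ⟨c, hc⟩ := hb'
    obtain ⟨v, -, hv, hC⟩ := exists_concurrent_step_below hc
    obtain rfl := hbelow v hC hv
    exact ⟨hv, hC⟩
  have hlow := hg.2.2 b.1 trivial
  rw [lowerSum_apply, Finset.sum_eq_single a] at hlow
  · exact hlow
  · intro v hv hva
    obtain ⟨-, h1, h2, h3⟩ := Finset.mem_filter.1 hv
    exact (hva (hbelow v h2 (lt_of_le_of_ne h1 (by rintro rfl; exact h3 rfl)))).elim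
  · intro h
    simp only [Finset.mem_filter, Finset.mem_univ, true_and] at h
    exact (h ⟨hba.1.le, hba.2, hl.symm⟩).elim

variable (k) in
theorem dimKer_le_of_prec {a : E} (h : E.PrecPlus a ∨ E.PrecMinus a) :
    E.dimKer k ≤ (E.delete a).dimKer k := by
  rw [delete, dimKer_subheap, dimKer_eq_finrank]
  refine Submodule.finrank_mono fun g hg => ⟨fun v hv => ?_, hg.2.1, fun w _ => hg.2.2 w trivial⟩
  obtain rfl : v = a := by simpa using hv
  rcases h with h | h
  · exact apply_eq_zero_of_precPlus h hg
  · exact apply_eq_zero_of_precMinus h hg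

variable (k) in
theorem IsTrivial.dimKer_eq_zero (h : E.IsTrivial) : E.dimKer k = 0 := by
  classical
  rw [dimKer_eq_finrank]
  have : E.cycleSpace k Set.univ = ⊥ := by
    rw [eq_bot_iff]
    intro g hg
    refine funext fun v => ?_
    have h1 := hg.2.1 (E.label v)
    rw [labelSum_apply, Finset.sum_eq_single v] at h1
    · exact h1
    · intro w hw hwv
      rcases comparable_of_label_eq (Finset.mem_filter.1 hw).2 with h' | h'
      · exact (hwv (h _ _ h')).elim
      · exact (hwv (h _ _ h').symm).elim
    · intro h
      simp at h
  rw [this, finrank_bot]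

end LabelledHeap

namespace Heap

open LabelledHeap

variable (k : Type*) [Field k]

theorem dimKer_sub (E : LabelledHeap P C) (S : Set E) :
    (sub E S).dimKer k = Module.finrank k (E.cycleSpace k S) := E.dimKer_subheap k S

theorem HasP1.dimKer_eq_zero {x : Heap P C} (h : x.HasP1) : x.dimKer k = 0 := by
  obtain ⟨t, ⟨T, rfl, hT⟩, h⟩ := h
  induction h with
  | refl => exact hT.dimKer_eq_zero k
  | tail _ h ih =>
    obtain ⟨E, a, rfl, rfl, h⟩ := h
    exact Nat.le_zero.1 ((dimKer_le_of_prec k h).trans ih.le)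

/-! ### Behaviour under reduction -/

namespace IsRedex

variable {k} {E : LabelledHeap P C} {f : E → ℕ} {x z : E} {T : Set E} {i : ℕ}

open Classical in
/-- The jump vector of the edge from `x` to `z`. -/
noncomputable def vec (k : Type*) [Field k] (x z : E) : E → k := Pi.single x 1 - Pi.single z 1

theorem labelSum_vec (h : IsRedex E Set.univ f x z T i) (p : P) :
    E.labelSum k p (vec k x z) = 0 := by
  rw [vec, map_sub, labelSum_single, labelSum_single, h.label_eq, sub_self]

open Classical in
-- A concurrent vertex outside `T` with another label is above both of `x` and `z` or above neither,
-- so the two jumps cancel.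
theorem lowerSum_vec (h : IsRedex E Set.univ f x z T i) (w : E) :
    E.lowerSum k w (vec k x z) = if w ∈ T then 1 else 0 := by
  rw [vec, map_sub, lowerSum_single, lowerSum_single, ← h.label_eq]
  by_cases hw : w ∈ T
  · obtain ⟨-, -, h1, h2, h3, h4⟩ := h.of_mem hw
    rw [if_pos hw, if_pos ⟨h1.le, h4, h3.symm⟩, if_neg (fun h => not_le_of_gt h2 h.1), sub_zero]
  · rw [if_neg hw]
    by_cases hC : C.rel (E.label x) (E.label w) ∧ E.label x ≠ E.label w
    · have : x ≤ w ↔ z ≤ w := by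
        refine ⟨fun hxw => ?_, fun hzw => h.lt.le.trans hzw⟩
        rcases E.comparable z w (by rw [← h.label_eq]; exact hC.1) with h' | h'
        · exact h'
        · rcases h.between hxw h' with rfl | rfl | h''
          · exact (hC.2 rfl).elim
          · exact le_rfl
          · exact (hw h'').elim
      rw [this, sub_self]
    · rw [if_neg (fun h => hC h.2), if_neg (fun h => hC h.2), sub_zero]

open Classical in
theorem lowerSum_right (h : IsRedex E Set.univ f x z T i) (g : E → k) :
    E.lowerSum k z g = E.lowerSum k x g + ∑ v : E with v ∈ T, g v := by
  rw [lowerSum_apply, lowerSum_apply, ← h.label_eq, ← Finset.sum_union]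
  · congr 1
    ext v
    simp only [Finset.mem_filter, Finset.mem_univ, true_and, Finset.mem_union]
    constructor
    · rintro ⟨h1, h2, h3⟩
      rcases E.comparable v x h2 with h' | h'
      · exact Or.inl ⟨h', h2, h3⟩
      · rcases h.between h' h1 with rfl | rfl | h''
        · exact (h3 rfl).elim
        · exact (h3 h.label_eq.symm).elim
        · exact Or.inr h''
    · rintro (⟨h1, h2, h3⟩ | hv)
      · exact ⟨h1.trans h.lt.le, h2, h3⟩
      · obtain ⟨-, -, h1, h2, h3, h4⟩ := h.of_mem hv
        exact ⟨h2.le, C.symm _ _ h4, h3⟩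
  · rw [Finset.disjoint_left]
    intro v hv hv'
    obtain ⟨-, h1, -⟩ := Finset.mem_filter.1 hv
    obtain ⟨-, -, h2, -⟩ := h.of_mem (Finset.mem_filter.1 hv').2
    exact not_le_of_gt h2 h1

theorem vec_right (h : IsRedex E Set.univ f x z T i) : vec k x z z = -1 := by
  simp [vec, h.ne.symm]

theorem vec_other {v : E} (h₁ : v ≠ x) (h₂ : v ≠ z) : vec k x z v = 0 := by
  simp [vec, h₁, h₂]

/-- The edge `(x, z)` has zero boundary, so evaluation at `z` maps the cycles onto `k`. Its kernel
consists of the cycles avoiding `z`; the equation at `z` is no loss, being the equation at `x`. -/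
theorem finrank_of_empty (h : IsRedex E Set.univ f x z ∅ i) :
    Module.finrank k (E.cycleSpace k Set.univ) =
      1 + Module.finrank k (E.cycleSpace k (Set.univ \ (∅ ∪ {z}))) := by
  classical
  have hd : vec k x z ∈ E.cycleSpace k Set.univ :=
    ⟨fun v hv => (hv trivial).elim, h.labelSum_vec, fun w _ => by simp [h.lowerSum_vec]⟩
  let ev : E.cycleSpace k Set.univ →ₗ[k] k :=
    (LinearMap.proj z).comp (E.cycleSpace k Set.univ).subtype
  have hrange : LinearMap.range ev = ⊤ := by
    rw [LinearMap.range_eq_top]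
    intro c
    refine ⟨-c • ⟨_, hd⟩, ?_⟩
    change -c * vec k x z z = c
    rw [h.vec_right]
    ring
  have hker : (LinearMap.ker ev).map (E.cycleSpace k Set.univ).subtype =
      E.cycleSpace k (Set.univ \ (∅ ∪ {z})) := by
    ext g
    constructor
    · rintro ⟨⟨g, hg⟩, hz, rfl⟩
      have hz' : g z = 0 := hz
      refine ⟨fun v hv => ?_, hg.2.1, fun w _ => hg.2.2 w trivial⟩
      obtain rfl : v = z := by simpa using hv
      exact hz'
    · intro hg
      have hz : g z = 0 := hg.1 z (by simp)
      refine ⟨⟨g, fun v hv => (hv trivial).elim, hg.2.1, fun w _ => ?_⟩, hz, rfl⟩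
      by_cases hw : w = z
      · subst hw
        rw [h.lowerSum_right, hg.2.2 x ⟨trivial, by simpa using h.ne⟩]
        simp
      · exact hg.2.2 w (by simpa using hw)
  rw [← ev.finrank_range_add_finrank_ker, hrange, finrank_top, Module.finrank_self, ← hker,
    LinearEquiv.finrank_eq (Submodule.equivSubtypeMap _ (LinearMap.ker ev))]

/-- The equations at `x` and `z` differ by the value at `y`, so cycles vanish at `y`. The value at
`z` can then be moved to `x`, and the equation at `y` determines how to move it back. -/
theorem finrank_of_singleton {y : E} (h : IsRedex E Set.univ f x z {y} i) :
    Module.finrank k (E.cycleSpace k Set.univ) =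
      Module.finrank k (E.cycleSpace k (Set.univ \ ({y} ∪ {z}))) := by
  classical
  obtain ⟨-, -, hxy, hyz, -⟩ := h.of_mem (Set.mem_singleton y)
  have hnot : ∀ v, v ∉ Set.univ \ ({y} ∪ {z}) ↔ v = y ∨ v = z := fun v => by simp; tauto
  have hright : ∀ g : E → k, E.lowerSum k z g = E.lowerSum k x g + g y := fun g => by
    rw [h.lowerSum_right, Finset.sum_eq_single y]
    · exact fun v hv hne => (hne (by simpa using hv)).elim
    · exact fun hy => (hy (by simp)).elim
  have hy : ∀ g ∈ E.cycleSpace k Set.univ, g y = 0 := fun g hg => by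
    have := hright g
    rwa [hg.2.2 z trivial, hg.2.2 x trivial, zero_add, eq_comm] at this
  -- Since `vec` is -1 at `z`, the map kills the value there and adds it at `x`; only `lowerSum y`
  -- is affected.
  let Φ : (E → k) →ₗ[k] (E → k) :=
    LinearMap.id + (LinearMap.proj z : (E → k) →ₗ[k] k).smulRight (vec k x z)
  have hΦ : ∀ g, Φ g = g + g z • vec k x z := fun g => rfl
  have hmap : ∀ g ∈ E.cycleSpace k Set.univ,
      Φ g ∈ E.cycleSpace k (Set.univ \ ({y} ∪ {z})) := by
    intro g hg
    rw [hΦ]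
    refine ⟨fun v hv => ?_, fun p => ?_, fun w hw => ?_⟩
    · rcases (hnot v).1 hv with rfl | rfl
      · simp [vec_other hxy.ne' hyz.ne, hy g hg]
      · simp [h.vec_right]
    · rw [map_add, map_smul, hg.2.1, h.labelSum_vec, smul_zero, add_zero]
    · have hw' : w ∉ ({y} : Set E) := fun hwy => hw.2 (Or.inl hwy)
      rw [map_add, map_smul, hg.2.2 w trivial, h.lowerSum_vec, if_neg hw', smul_zero, add_zero]
  refine LinearEquiv.finrank_eq (LinearEquiv.ofBijective (Φ.restrict hmap) ⟨?_, ?_⟩)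
  · rw [← LinearMap.ker_eq_bot, LinearMap.ker_eq_bot']
    rintro ⟨g, hg⟩ h0
    have h0' : g + g z • vec k x z = 0 := congrArg Subtype.val h0
    have h1 := congrArg (E.lowerSum k y) h0'
    rw [map_add, map_smul, hg.2.2 y trivial, h.lowerSum_vec, if_pos (Set.mem_singleton y),
      map_zero, zero_add, smul_eq_mul, mul_one] at h1
    rw [h1, zero_smul, add_zero] at h0'
    exact Subtype.ext h0'
  · rintro ⟨g, hg⟩
    have hgz : g z = 0 := hg.1 z ((hnot z).2 (Or.inr rfl))
    have hgy : g y = 0 := hg.1 y ((hnot y).2 (Or.inl rfl))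
    have hgx : E.lowerSum k x g = 0 := hg.2.2 x (by
      by_contra hx
      rcases (hnot x).1 hx with h' | h'
      exacts [hxy.ne h', h.ne h'])
    -- The coefficient is forced: `vec` has `lowerSum` equal to 1 at `y`, where the equation must be
    -- restored.
    refine ⟨⟨g - E.lowerSum k y g • vec k x z, fun v hv => (hv trivial).elim, fun p => ?_,
      fun w _ => ?_⟩, Subtype.ext ?_⟩
    · rw [map_sub, map_smul, hg.2.1, h.labelSum_vec, smul_zero, sub_zero]
    · rw [map_sub, map_smul, h.lowerSum_vec]
      by_cases hwy : w = y
      · subst hwy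
        simp
      · rw [if_neg (by simpa using hwy), smul_zero, sub_zero]
        by_cases hwz : w = z
        · subst hwz
          rw [hright, hgx, hgy, add_zero]
        · exact hg.2.2 w (by
            by_contra hw
            rcases (hnot w).1 hw with h' | h'
            exacts [hwy h', hwz h'])
    · change Φ _ = g
      rw [hΦ]
      simp [hgz, h.vec_right]

end IsRedex

theorem Red.dimKer_eq {i : ℕ} {x y : Heap P C} (h : Red i x y) :
    x.dimKer k = i + y.dimKer k := by
  obtain ⟨E, rfl⟩ := exists_mk x
  rw [← sub_univ] at h ⊢
  obtain ⟨f, x, z, T, R, hy⟩ := h.exists_isRedex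
  rw [hy _ (Or.inr rfl), dimKer_sub, dimKer_sub]
  rcases R.middle_cases with ⟨rfl, rfl⟩ | ⟨y, rfl, rfl, -⟩
  · exact R.finrank_of_empty
  · rw [zero_add]
    exact R.finrank_of_singleton

theorem NF.dimKer_eq {x g : Heap P C} {m : ℕ} (h : NF x m g) :
    x.dimKer k = m + g.dimKer k := by
  induction h with
  | refl x _ => rw [zero_add]
  | step hr _ ih => rw [hr.dimKer_eq k, ih, add_assoc]

end Heap

/-- Setting `v = 1` sends δ to 2. -/
theorem delta_pow_injective : Function.Injective fun m : ℕ => delta ^ m := by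
  intro m n h
  have h' := congrArg (LaurentPolynomial.eval₂ (RingHom.id ℤ) 1) h
  have hd : LaurentPolynomial.eval₂ (RingHom.id ℤ) 1 delta = 2 := by
    rw [delta, map_add, LaurentPolynomial.eval₂_T, LaurentPolynomial.eval₂_T]
    simp
  simp only [map_pow, hd] at h'
  exact Nat.pow_right_injective (le_refl 2) (by exact_mod_cast h')

theorem delta_pow_ne_zero (m : ℕ) : delta ^ m ≠ 0 := by
  intro h
  have h' : delta ^ (m + 1) = delta ^ m := by rw [pow_succ, h, zero_mul]
  have := delta_pow_injective h'
  omega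

namespace Heap

/-! ### Heaps in the algebra -/

theorem toTL_mul (x y : Heap P C) : (x * y).toTL = x.toTL * y.toTL := by
  unfold toTL
  rw [toCo_mul, map_mul, map_mul]

theorem toTL_one : (1 : Heap P C).toTL = 1 := by
  rw [toTL, toCo_one, map_one, map_one]

theorem toTL_single (p : P) :
    (single C p).toTL = RingQuot.mkAlgHom ℤ[T;T⁻¹] (TLRel C) (gen C p) := by
  rw [toTL, toCo_single, gen]

theorem Red.toTL_eq {i : ℕ} {x y : Heap P C} (h : Red i x y) :
    x.toTL = delta ^ i • y.toTL := by
  obtain ⟨a, s, m, b, i, hm⟩ := h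
  simp only [toTL_mul]
  rcases hm with ⟨rfl, rfl⟩ | ⟨t, hts, hC, rfl, rfl⟩
  · have h1 := RingQuot.mkAlgHom_rel ℤ[T;T⁻¹] (TLRel.sq (C := C) s)
    rw [map_mul, map_smul, ← toTL_single] at h1
    rw [toTL_one, one_mul, ← mul_assoc (single C s).toTL, h1, pow_one,
      smul_mul_assoc, mul_smul_comm]
  · have h1 := RingQuot.mkAlgHom_rel ℤ[T;T⁻¹] (TLRel.braid (C := C) s t hts.symm hC)
    rw [map_mul, map_mul, ← toTL_single, ← toTL_single] at h1
    rw [← mul_assoc (single C t).toTL, ← mul_assoc (single C s).toTL,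
      ← mul_assoc (single C s).toTL, h1, pow_zero, one_smul]

theorem NF.toTL_eq {x g : Heap P C} {m : ℕ} (h : NF x m g) :
    x.toTL = delta ^ m • g.toTL := by
  induction h with
  | refl x _ => rw [pow_zero, one_smul]
  | step hr _ ih => rw [hr.toTL_eq, ih, smul_smul, pow_add]

/-! ### The action on the free module spanned by the heaps with property P2 -/

/-- The free module on the heaps with property P2. -/
abbrev P2Module (C : Concurrency P) : Type _ := {G : Heap P C // G.HasP2} →₀ ℤ[T;T⁻¹]

theorem NF.hasP2 {x g : Heap P C} {m : ℕ} (h : NF x m g) : g.HasP2 :=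
  (hasP2_iff_irred g).2 h.irred

theorem NF.of_hasP2 {x : Heap P C} (h : x.HasP2) : NF x 0 x :=
  .refl x ((hasP2_iff_irred x).1 h)

/-- The normal form of a heap in the free module on the heaps with property P2. -/
noncomputable def normalForm (x : Heap P C) : P2Module C :=
  Finsupp.single ⟨_, (NF.exists x).choose_spec.choose_spec.hasP2⟩ (delta ^ (NF.exists x).choose)

theorem NF.normalForm_eq {x g : Heap P C} {m : ℕ} (h : NF x m g) :
    normalForm x = Finsupp.single ⟨g, h.hasP2⟩ (delta ^ m) := by
  obtain ⟨h1, h2⟩ := (NF.exists x).choose_spec.choose_spec.unique h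
  unfold normalForm
  congr 1
  · exact Subtype.ext h2
  · rw [h1]

theorem normalForm_of_hasP2 (G : {G : Heap P C // G.HasP2}) :
    normalForm G.1 = Finsupp.single G 1 := by
  rw [(NF.of_hasP2 G.2).normalForm_eq, pow_zero]

theorem Red.normalForm_eq {i : ℕ} {x y : Heap P C} (h : Red i x y) :
    normalForm x = delta ^ i • normalForm y := by
  obtain ⟨m, g, hg⟩ := NF.exists y
  rw [hg.normalForm_eq, (NF.step h hg).normalForm_eq, Finsupp.smul_single, smul_eq_mul, pow_add]

/-- Left multiplication by a heap, followed by reduction. -/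
noncomputable def act (c : Heap P C) : P2Module C →ₗ[ℤ[T;T⁻¹]] P2Module C :=
  Finsupp.linearCombination ℤ[T;T⁻¹] fun G => normalForm (c * G.1)

theorem act_single (c : Heap P C) (G : {G : Heap P C // G.HasP2}) (r : ℤ[T;T⁻¹]) :
    act c (Finsupp.single G r) = r • normalForm (c * G.1) :=
  Finsupp.linearCombination_single _ _ _

theorem act_normalForm (c x : Heap P C) : act c (normalForm x) = normalForm (c * x) := by
  obtain ⟨m, g, h⟩ := NF.exists x
  obtain ⟨m', g', h'⟩ := NF.exists (c * g)
  rw [h.normalForm_eq, act_single, h'.normalForm_eq, (h.mul_left h').normalForm_eq,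
    Finsupp.smul_single, smul_eq_mul, pow_add]

/-- The action of the monoid of heaps. -/
noncomputable def actHom (C : Concurrency P) :
    Heap P C →* Module.End ℤ[T;T⁻¹] (P2Module C) where
  toFun := act
  map_one' := by
    refine Finsupp.lhom_ext fun G r => ?_
    rw [act_single, one_mul, normalForm_of_hasP2, Finsupp.smul_single, smul_eq_mul, mul_one]
    rfl
  map_mul' c d := by
    refine Finsupp.lhom_ext fun G r => ?_
    rw [Module.End.mul_apply, act_single, act_single, map_smul, act_normalForm, mul_assoc]

/-- Reductions persist under right multiplication by `G`. The defining relations are themselves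
reductions, so the action descends to the algebra. -/
theorem actHom_eq_of_red {i : ℕ} {x y : Heap P C} (h : Red i x y) :
    actHom C x = delta ^ i • actHom C y := by
  refine Finsupp.lhom_ext fun G r => ?_
  change act x _ = (delta ^ i • act y) _
  rw [LinearMap.smul_apply, act_single, act_single, (h.mul_right G.1).normalForm_eq, smul_comm]

/-- The action of the monoid algebra. -/
noncomputable def coAlgAction (C : Concurrency P) :
    CoAlg C →ₐ[ℤ[T;T⁻¹]] Module.End ℤ[T;T⁻¹] (P2Module C) :=
  MonoidAlgebra.lift _ _ _ ((actHom C).comp (ofCo C))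

theorem coAlgAction_of (x : Heap P C) :
    coAlgAction C (MonoidAlgebra.of _ _ x.toCo) = actHom C x := by
  rw [coAlgAction, MonoidAlgebra.lift_of, MonoidHom.comp_apply, ofCo_toCo]

theorem coAlgAction_gen (p : P) : coAlgAction C (gen C p) = actHom C (single C p) := by
  rw [← coAlgAction_of, toCo_single, gen]

theorem coAlgAction_rel {x y : CoAlg C} (h : TLRel C x y) :
    coAlgAction C x = coAlgAction C y := by
  cases h with
  | sq s =>
    rw [map_mul, map_smul, coAlgAction_gen, ← map_mul]
    have h := actHom_eq_of_red (Red.intro 1 s 1 1 1 (Or.inl ⟨rfl, rfl⟩) : Red (C := C) _ _ _)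
    simpa only [one_mul, mul_one, pow_one] using h
  | braid s t hst hC =>
    rw [map_mul, map_mul, coAlgAction_gen, coAlgAction_gen, ← map_mul, ← map_mul]
    have h := actHom_eq_of_red (Red.intro 1 s (single C t) 1 0
      (Or.inr ⟨t, hst.symm, hC, rfl, rfl⟩) : Red (C := C) _ _ _)
    simpa only [one_mul, mul_one, pow_zero, one_smul, ← mul_assoc] using h

/-- The action of the generalized Temperley–Lieb algebra. -/
noncomputable def tlAction (C : Concurrency P) :
    TL C →ₐ[ℤ[T;T⁻¹]] Module.End ℤ[T;T⁻¹] (P2Module C) :=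
  RingQuot.liftAlgHom _ ⟨coAlgAction C, fun _ _ h => coAlgAction_rel h⟩

theorem tlAction_toTL (x : Heap P C) : tlAction C x.toTL = actHom C x := by
  rw [tlAction, toTL, RingQuot.liftAlgHom_mkAlgHom_apply, coAlgAction_of]

/-- The coordinates of an element of the algebra in the basis of heaps with property P2. -/
noncomputable def coords (C : Concurrency P) : TL C →ₗ[ℤ[T;T⁻¹]] P2Module C :=
  (LinearMap.applyₗ (normalForm 1)).comp (tlAction C).toLinearMap

theorem coords_toTL (x : Heap P C) : coords C x.toTL = normalForm x := by
  change tlAction C x.toTL (normalForm 1) = _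
  rw [tlAction_toTL]
  change act x _ = _
  rw [act_normalForm, mul_one]

/-- A P2 heap is its own normal form, so `coords` sends the family to the standard basis. -/
theorem linearIndependent_toTL (C : Concurrency P) :
    LinearIndependent ℤ[T;T⁻¹] (fun G : {G : Heap P C // G.HasP2} => G.1.toTL) := by
  refine LinearIndependent.of_comp (coords C) ?_
  convert Finsupp.linearIndependent_single_one ℤ[T;T⁻¹] {G : Heap P C // G.HasP2} using 1
  funext G
  exact (coords_toTL G.1).trans (normalForm_of_hasP2 G)

theorem span_toTL (C : Concurrency P) : Submodule.span ℤ[T;T⁻¹]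
    (Set.range (fun G : {G : Heap P C // G.HasP2} => G.1.toTL)) = ⊤ := by
  rw [eq_top_iff]
  rintro t -
  obtain ⟨a, rfl⟩ := RingQuot.mkAlgHom_surjective ℤ[T;T⁻¹] (TLRel C) t
  induction a using MonoidAlgebra.induction_on with
  | of x =>
    rw [← toCo_ofCo x]
    obtain ⟨m, g, h⟩ := NF.exists (ofCo C x)
    change (ofCo C x).toTL ∈ _
    rw [h.toTL_eq]
    exact Submodule.smul_mem _ _ (Submodule.subset_span ⟨⟨g, h.hasP2⟩, rfl⟩)
  | add a b ha hb => rw [map_add]; exact add_mem ha hb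
  | smul r a ha => rw [map_smul]; exact Submodule.smul_mem _ _ ha

/-- Any equation in the algebra, not only one obtained by rewriting, is compared with the normal
form through `coords`. -/
theorem NF.eq_of_toTL {x g G : Heap P C} {m n : ℕ} (h : NF x m g) (hG : G.HasP2)
    (he : x.toTL = delta ^ n • G.toTL) : n = m ∧ G = g := by
  have h1 := congrArg (coords C) he
  rw [map_smul, coords_toTL, coords_toTL, h.normalForm_eq, normalForm_of_hasP2 ⟨G, hG⟩,
    Finsupp.smul_single, smul_eq_mul, mul_one] at h1
  rcases Finsupp.single_eq_single_iff _ _ _ _ |>.1 h1 with ⟨h2, h3⟩ | ⟨h2, -⟩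
  · exact ⟨(delta_pow_injective h3).symm, (congrArg Subtype.val h2).symm⟩
  · exact (delta_pow_ne_zero m h2).elim

end Heap

end HeapTL

open HeapTL in
theorem theorem3p2p3 {P : Type*} (C : Concurrency P) (k : Type*) [Field k] :
    -- the heaps with property P2 form a basis of the algebra
    (LinearIndependent ℤ[T;T⁻¹] (fun G : {G : Heap P C // G.HasP2} => G.1.toTL) ∧
      Submodule.span ℤ[T;T⁻¹]
        (Set.range (fun G : {G : Heap P C // G.HasP2} => G.1.toTL)) = ⊤) ∧
    -- part (i)
    (∀ D : Heap P C,
      (∃! G : Heap P C, G.HasP2 ∧ ∃ m : ℕ, D.toTL = delta ^ m • G.toTL) ∧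
      (∀ (G : Heap P C) (m : ℕ), G.HasP2 → D.toTL = delta ^ m • G.toTL →
        D.dimKer k = m + G.dimKer k ∧ (IsRegular C → m = D.dimKer k))) ∧
    -- part (ii)
    (IsRegular C → ∀ E F : Heap P C, E.HasP2 → F.HasP2 →
      (E.superpose F).toTL = E.toTL * F.toTL ∧
      ∃ G : Heap P C, G.HasP2 ∧
        E.toTL * F.toTL = delta ^ ((E.superpose F).dimKer k) • G.toTL) := by
  refine ⟨⟨Heap.linearIndependent_toTL C, Heap.span_toTL C⟩, fun D => ?_, fun hreg E F _ _ => ?_⟩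
  · obtain ⟨n, g, h⟩ := Heap.NF.exists D
    refine ⟨⟨g, ⟨h.hasP2, n, h.toTL_eq⟩, ?_⟩, ?_⟩
    · rintro G ⟨hG, m, he⟩
      exact (h.eq_of_toTL hG he).2
    · intro G m hG he
      obtain ⟨rfl, rfl⟩ := h.eq_of_toTL hG he
      have hd := h.dimKer_eq k
      refine ⟨hd, fun hreg => ?_⟩
      -- Regularity turns P2 for `G` into P1, so its kernel is zero.
      rw [hd, (hreg _ hG).dimKer_eq_zero k, add_zero]
  · have hmul : (E.superpose F).toTL = E.toTL * F.toTL := Heap.toTL_mul E F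
    obtain ⟨n, g, h⟩ := Heap.NF.exists (E.superpose F)
    refine ⟨hmul, g, h.hasP2, ?_⟩
    rw [← hmul, h.dimKer_eq k, (hreg _ h.hasP2).dimKer_eq_zero k, add_zero]
    exact h.toTL_eq
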